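/- Let $\Bbbk$ be a field of characteristic different from $2$. A formal super $\Bbbk$-functor is a covariant functor from finite-dimensional supercommutative $\Bbbk$-superalgebras to sets. A formal superscheme is a formal super $\Bbbk$-functor isomorphic to the inductive limit of a (non-empty) directed system of functors $\mathrm{SSpf}\,A_\lambda=\mathrm{Hom}(A_\lambda,-)$, with $A_\lambda$ a finite-dimensional supercommutative $\Bbbk$-superalgebra and transition maps induced by surjections $A_\mu\to A_\lambda$; formal superschemes form a full subcategory of the category of formal super $\Bbbk$-functors. For a super-cocommutative super-coalgebra $\mathbf{A}$ let $\mathrm{Sp}^*\mathbf{A}$ be the functor sending $R$ to the set of group-like elements of $R\otimes\mathbf{A}$, i.e. even $u\in R\otimes\mathbf{A}$ with $\Delta(u)=u\otimes_R u$ and $\epsilon(u)=1$. A map $\mathbf{f}:\mathfrak{X}\to\mathfrak{Y}$ of formal superschemes which, under isomorphisms $\mathfrak{X}\cong\mathrm{Sp}^*\mathbf{A}$ and $\mathfrak{Y}\cong\mathrm{Sp}^*\mathbf{B}$, corresponds to a morphism of super-coalgebras $\psi:\mathbf{A}\to\mathbf{B}$ is called faithfully flat if the cotensor functor $\mathbf{f}^*=-\,\square_{\mathbf{B}}\mathbf{A}$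 on right $\mathbf{B}$-super-comodules is faithfully exact, i.e. a sequence $L\to M\to N$ of $\mathbf{B}$-super-comodules is exact if and only if $L\,\square_{\mathbf{B}}\mathbf{A}\to M\,\square_{\mathbf{B}}\mathbf{A}\to N\,\square_{\mathbf{B}}\mathbf{A}$ is exact. **Theorem (Faithfully Flat Descent).** If $\mathbf{f}:\mathfrak{X}\to\mathfrak{Y}$ is a faithfully flat map of formal superschemes over $\Bbbk$, then the fiber product $\mathfrak{X}\times_{\mathfrak{Y}}\mathfrak{X}$ exists in the category of formal superschemes, and, with $\pi_1,\pi_2$ its two projections, the diagram $$\mathfrak{X}\times_{\mathfrak{Y}}\mathfrak{X}\;\underset{\pi_2}{\overset{\pi_1}{\rightrightarrows}}\;\mathfrak{X}\xrightarrow{\ \mathbf{f}\ }\mathfrak{Y}$$ is exact in the category of formal superschemes, i.e. $\mathbf{f}$ is the coequalizer of $\pi_1$ and $\pi_2$ in that category. -/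

import Mathlib

open CategoryTheory CategoryTheory.Limits
open scoped TensorProduct

universe u

noncomputable section

namespace FormalSuper

/-! ### Super vector spaces

A super vector space is a `k`-module `V` with a decomposition `V = V₀ ⊕ V₁`, given by a
`ZMod 2`-indexed family of submodules. -/

section SuperSpaces

variable {k : Type u} [Field k]
variable {V W V' W' : Type u} [AddCommGroup V] [Module k V] [AddCommGroup W] [Module k W]
  [AddCommGroup V'] [Module k V'] [AddCommGroup W'] [Module k W']

/-- The grading of `V ⊗ W`: the part of degree `n` is the sum of the `V_i ⊗ W_(n - i)`. -/
def tensorGrading (𝒱 : ZMod 2 → Submodule k V) (𝒲 : ZMod 2 → Submodule k W) (n : ZMod 2) :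
    Submodule k (V ⊗[k] W) :=
  ⨆ i : ZMod 2, Submodule.map₂ (TensorProduct.mk k V W) (𝒱 i) (𝒲 (n - i))

/-- A linear map is a morphism of super vector spaces if it preserves degrees. -/
def IsEven (𝒱 : ZMod 2 → Submodule k V) (𝒲 : ZMod 2 → Submodule k W) (f : V →ₗ[k] W) : Prop :=
  ∀ i : ZMod 2, ∀ v ∈ 𝒱 i, f v ∈ 𝒲 i

/-- The field `k` as a super vector space, purely even. -/
def unitGrading (k : Type u) [Field k] (i : ZMod 2) : Submodule k k := if i = 0 then ⊤ else ⊥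

/-- The twisting map `c : V ⊗ W → W ⊗ V`, `v ⊗ w ↦ (-1)^(|v||w|) w ⊗ v`. -/
def twist (𝒱 : ZMod 2 → Submodule k V) (𝒲 : ZMod 2 → Submodule k W)
    [DirectSum.Decomposition 𝒱] [DirectSum.Decomposition 𝒲] : V ⊗[k] W →ₗ[k] W ⊗[k] V :=
  (TensorProduct.congr (DirectSum.decomposeLinearEquiv 𝒱) (DirectSum.decomposeLinearEquiv 𝒲) ≪≫ₗ
    TensorProduct.gradedComm k (fun i => 𝒱 i) (fun i => 𝒲 i) ≪≫ₗ
    (TensorProduct.congr (DirectSum.decomposeLinearEquiv 𝒲)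
      (DirectSum.decomposeLinearEquiv 𝒱)).symm).toLinearMap

theorem twist_tmul (𝒱 : ZMod 2 → Submodule k V) (𝒲 : ZMod 2 → Submodule k W)
    [DirectSum.Decomposition 𝒱] [DirectSum.Decomposition 𝒲] {i j : ZMod 2} {v : V} {w : W}
    (hv : v ∈ 𝒱 i) (hw : w ∈ 𝒲 j) :
    twist 𝒱 𝒲 (v ⊗ₜ w) = ((-1 : ℤˣ) ^ (j * i)) • (w ⊗ₜ[k] v) := by
  lift v to 𝒱 i using hv
  lift w to 𝒲 j using hw
  simp only [twist, LinearEquiv.coe_coe, LinearEquiv.trans_apply, TensorProduct.congr_tmul,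
    DirectSum.decomposeLinearEquiv_apply_coe]
  rw [TensorProduct.gradedComm_of_tmul_of]
  simp only [Units.smul_def, map_zsmul, TensorProduct.congr_symm_tmul,
    DirectSum.decomposeLinearEquiv_symm_lof]

theorem twist_map (𝒱 : ZMod 2 → Submodule k V) (𝒲 : ZMod 2 → Submodule k W)
    (𝒱' : ZMod 2 → Submodule k V') (𝒲' : ZMod 2 → Submodule k W')
    [DirectSum.Decomposition 𝒱] [DirectSum.Decomposition 𝒲]
    [DirectSum.Decomposition 𝒱'] [DirectSum.Decomposition 𝒲']
    {f : V →ₗ[k] V'} {g : W →ₗ[k] W'} (hf : IsEven 𝒱 𝒱' f) (hg : IsEven 𝒲 𝒲' g) :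
    twist 𝒱' 𝒲' ∘ₗ TensorProduct.map f g = TensorProduct.map g f ∘ₗ twist 𝒱 𝒲 := by
  ext v w
  simp only [TensorProduct.AlgebraTensorModule.curry_apply, LinearMap.restrictScalars_self,
    TensorProduct.curry_apply, LinearMap.comp_apply, TensorProduct.map_tmul]
  induction v using DirectSum.Decomposition.inductionOn 𝒱 with
  | zero => simp
  | add a b ha hb => simp only [map_add, TensorProduct.add_tmul, ha, hb]
  | homogeneous v =>
    induction w using DirectSum.Decomposition.inductionOn 𝒲 with
    | zero => simp
    | add a b ha hb => simp only [map_add, TensorProduct.tmul_add, ha, hb]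
    | homogeneous w =>
      rw [twist_tmul 𝒱' 𝒲' (hf _ _ v.2) (hg _ _ w.2), twist_tmul 𝒱 𝒲 v.2 w.2]
      simp only [Units.smul_def, map_zsmul, TensorProduct.map_tmul]

theorem tensorGrading_map {𝒱 : ZMod 2 → Submodule k V} {𝒲 : ZMod 2 → Submodule k W}
    {𝒱' : ZMod 2 → Submodule k V'} {𝒲' : ZMod 2 → Submodule k W'}
    {f : V →ₗ[k] V'} {g : W →ₗ[k] W'} (hf : IsEven 𝒱 𝒱' f) (hg : IsEven 𝒲 𝒲' g) :
    IsEven (tensorGrading 𝒱 𝒲) (tensorGrading 𝒱' 𝒲') (TensorProduct.map f g) := by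
  intro n
  change tensorGrading 𝒱 𝒲 n ≤ (tensorGrading 𝒱' 𝒲' n).comap (TensorProduct.map f g)
  refine iSup_le fun i => Submodule.map₂_le.2 fun v hv w hw => ?_
  refine Submodule.mem_iSup_of_mem i ?_
  exact Submodule.apply_mem_map₂ (TensorProduct.mk k V' W') (hf _ _ hv) (hg _ _ hw)

end SuperSpaces

/-! ### Finite-dimensional superalgebras -/

/-- A finite-dimensional supercommutative `k`-superalgebra: even elements are central and odd
elements have square zero. -/
structure SAlgf (k : Type u) [Field k] where
  carrier : Type u
  [ring : Ring carrier]
  [algebra : Algebra k carrier]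
  grading : ZMod 2 → Submodule k carrier
  [gradedAlgebra : GradedAlgebra grading]
  [finite : Module.Finite k carrier]
  even_central : ∀ x ∈ grading 0, ∀ y : carrier, x * y = y * x
  odd_sq : ∀ x ∈ grading 1, x * x = 0

namespace SAlgf

attribute [instance] ring algebra gradedAlgebra finite

variable {k : Type u} [Field k]

/-- A morphism of superalgebras: a degree-preserving `k`-algebra homomorphism. -/
@[ext]
structure Hom (R S : SAlgf k) where
  toAlgHom : R.carrier →ₐ[k] S.carrier
  isEven : IsEven R.grading S.grading toAlgHom.toLinearMap

instance : Category (SAlgf k) where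
  Hom R S := Hom R S
  id R := ⟨AlgHom.id k R.carrier, fun _ _ h => h⟩
  comp f g := ⟨g.toAlgHom.comp f.toAlgHom, fun i v h => g.isEven i _ (f.isEven i v h)⟩

end SAlgf

/-! ### Super-cocommutative super-coalgebras -/

/-- A super-cocommutative (coassociative, counital) super-coalgebra over `k`. -/
structure SCoalg (k : Type u) [Field k] where
  carrier : Type u
  [addCommGroup : AddCommGroup carrier]
  [module : Module k carrier]
  [coalgebra : Coalgebra k carrier]
  grading : ZMod 2 → Submodule k carrier
  [decomposition : DirectSum.Decomposition grading]
  comul_isEven : IsEven grading (tensorGrading grading grading)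
    (Coalgebra.comul : carrier →ₗ[k] carrier ⊗[k] carrier)
  counit_isEven : IsEven grading (unitGrading k) (Coalgebra.counit : carrier →ₗ[k] k)
  super_cocomm : twist grading grading ∘ₗ Coalgebra.comul =
    (Coalgebra.comul : carrier →ₗ[k] carrier ⊗[k] carrier)

namespace SCoalg

attribute [instance] addCommGroup module coalgebra decomposition

variable {k : Type u} [Field k]

/-- A morphism of super-coalgebras: a degree-preserving morphism of coalgebras. -/
@[ext]
structure Hom (A B : SCoalg k) where
  toCoalgHom : A.carrier →ₗc[k] B.carrier
  isEven : IsEven A.grading B.grading toCoalgHom.toLinearMap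

instance : Category (SCoalg k) where
  Hom A B := Hom A B
  id A := ⟨CoalgHom.id k A.carrier, fun _ _ h => h⟩
  comp f g := ⟨g.toCoalgHom.comp f.toCoalgHom, fun i v h => g.isEven i _ (f.isEven i v h)⟩

/-- The linear map underlying a morphism of super-coalgebras. -/
def lin {A B : SCoalg k} (ψ : A ⟶ B) : A.carrier →ₗ[k] B.carrier :=
  (Hom.toCoalgHom ψ).toLinearMap

end SCoalg

/-! ### Formal super `k`-functors and formal superschemes -/

/-- Formal super `k`-functors: covariant functors from finite-dimensional supercommutative
superalgebras to sets. -/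
abbrev SFFunt (k : Type u) [Field k] := SAlgf k ⥤ Type u

/-- `SSpf A = Hom(A, -)`, as a contravariant functor of the finite-dimensional superalgebra `A`. -/
abbrev SSpf (k : Type u) [Field k] : (SAlgf k)ᵒᵖ ⥤ SFFunt k := coyoneda

/-- A formal super `k`-functor is a formal superscheme if it is isomorphic to the inductive limit
(in the category of formal super `k`-functors) of a directed system of finite affine superschemes
`SSpf (A l)` whose transition maps are closed immersions, i.e. are induced by surjective
morphisms of superalgebras. -/
def IsFormalSuperscheme (k : Type u) [Field k] : ObjectProperty (SFFunt k) := fun X =>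
  ∃ (J : Type u) (_ : PartialOrder J) (_ : Nonempty J) (_ : IsDirectedOrder J)
    (A : J ⥤ (SAlgf k)ᵒᵖ),
    (∀ (l m : J) (u : l ⟶ m), Function.Surjective (SAlgf.Hom.toAlgHom (A.map u).unop)) ∧
      Nonempty (X ≅ colimit (A ⋙ SSpf k))

/-- The category of formal superschemes over `k`: a full subcategory of the category of formal
super `k`-functors. -/
abbrev FormalSuperscheme (k : Type u) [Field k] := (IsFormalSuperscheme k).FullSubcategory

/-! ### The functor `Sp*` -/

section SpStar

variable {k : Type u} [Field k]

/-- For a superalgebra `R` and a super-coalgebra `A`, the map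
`(r ⊗ a) ⊗ (r' ⊗ a') ↦ (r ⊗ a) ⊗_R (r' ⊗ a')`, where `(R ⊗ A) ⊗_R (R ⊗ A)` is identified with
`R ⊗ (A ⊗ A)` through `(r ⊗ a) ⊗_R (r' ⊗ a') = (-1)^(|a||r'|) r r' ⊗ (a ⊗ a')`. -/
def tensorOver (R : SAlgf k) (A : SCoalg k) :
    (R.carrier ⊗[k] A.carrier) ⊗[k] (R.carrier ⊗[k] A.carrier) →ₗ[k]
      R.carrier ⊗[k] (A.carrier ⊗[k] A.carrier) :=
  (LinearMap.mul' k R.carrier).rTensor (A.carrier ⊗[k] A.carrier) ∘ₗ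
    (TensorProduct.assoc k R.carrier R.carrier (A.carrier ⊗[k] A.carrier)).symm.toLinearMap ∘ₗ
    LinearMap.lTensor R.carrier
      ((TensorProduct.assoc k R.carrier A.carrier A.carrier).toLinearMap ∘ₗ
        (twist A.grading R.grading).rTensor A.carrier ∘ₗ
        (TensorProduct.assoc k A.carrier R.carrier A.carrier).symm.toLinearMap) ∘ₗ
    (TensorProduct.assoc k R.carrier A.carrier (R.carrier ⊗[k] A.carrier)).toLinearMap

theorem tensorOver_tmul (R : SAlgf k) (A : SCoalg k) {i j : ZMod 2} (r r' : R.carrier)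
    (a a' : A.carrier) (ha : a ∈ A.grading i) (hr : r' ∈ R.grading j) :
    tensorOver R A ((r ⊗ₜ a) ⊗ₜ (r' ⊗ₜ a')) =
      ((-1 : ℤˣ) ^ (j * i)) • ((r * r') ⊗ₜ[k] (a ⊗ₜ[k] a')) := by
  simp only [tensorOver, LinearMap.comp_apply, LinearEquiv.coe_coe, TensorProduct.assoc_tmul,
    LinearMap.lTensor_tmul, TensorProduct.assoc_symm_tmul, LinearMap.rTensor_tmul,
    twist_tmul A.grading R.grading ha hr, Units.smul_def, ← Int.cast_smul_eq_zsmul k,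
    ← TensorProduct.smul_tmul', map_smul, TensorProduct.tmul_smul, LinearMap.mul'_apply]

/-- `u ∈ R ⊗ A` is group-like if it is even, `Δ(u) = u ⊗_R u` and `ε(u) = 1`, where `Δ` and `ε`
are the `R`-linear extensions of the structure maps of `A`. -/
structure IsGroupLike (R : SAlgf k) (A : SCoalg k) (u : R.carrier ⊗[k] A.carrier) : Prop where
  even : u ∈ tensorGrading R.grading A.grading 0
  comul : LinearMap.lTensor R.carrier Coalgebra.comul u = tensorOver R A (u ⊗ₜ u)
  counit : TensorProduct.rid k R.carrier (LinearMap.lTensor R.carrier Coalgebra.counit u) = 1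

theorem tensorOver_map {R S : SAlgf k} {A B : SCoalg k} (φ : R ⟶ S) (ψ : A ⟶ B)
    (u v : R.carrier ⊗[k] A.carrier) :
    tensorOver S B (TensorProduct.map (SAlgf.Hom.toAlgHom φ).toLinearMap (SCoalg.lin ψ) u ⊗ₜ
      TensorProduct.map (SAlgf.Hom.toAlgHom φ).toLinearMap (SCoalg.lin ψ) v) =
    TensorProduct.map (SAlgf.Hom.toAlgHom φ).toLinearMap
      (TensorProduct.map (SCoalg.lin ψ) (SCoalg.lin ψ)) (tensorOver R A (u ⊗ₜ v)) := by
  induction u with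
  | zero => simp
  | add x y hx hy => simp only [map_add, TensorProduct.add_tmul, hx, hy]
  | tmul r a =>
    induction v with
    | zero => simp
    | add x y hx hy => simp only [map_add, TensorProduct.tmul_add, hx, hy]
    | tmul r' a' =>
      induction a using DirectSum.Decomposition.inductionOn A.grading with
      | zero => simp
      | add x y hx hy => simp only [map_add, TensorProduct.tmul_add, TensorProduct.add_tmul, hx, hy]
      | homogeneous a =>
        induction r' using DirectSum.Decomposition.inductionOn R.grading with
        | zero => simp
        | add x y hx hy =>
          simp only [map_add, TensorProduct.tmul_add, TensorProduct.add_tmul, hx, hy]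
        | homogeneous r' =>
          rw [tensorOver_tmul R A r r' a a' a.2 r'.2]
          refine (tensorOver_tmul S B _ _ _ _ (ψ.isEven _ _ a.2) (φ.isEven _ _ r'.2)).trans ?_
          simp [Units.smul_def, map_zsmul, TensorProduct.map_tmul, SCoalg.lin]

theorem IsGroupLike.map {R S : SAlgf k} {A B : SCoalg k} (φ : R ⟶ S) (ψ : A ⟶ B)
    {u : R.carrier ⊗[k] A.carrier} (hu : IsGroupLike R A u) :
    IsGroupLike S B
      (TensorProduct.map (SAlgf.Hom.toAlgHom φ).toLinearMap (SCoalg.lin ψ) u) where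
  even := tensorGrading_map φ.isEven ψ.isEven 0 u hu.even
  comul := by
    rw [tensorOver_map, ← hu.comul]
    simp only [← LinearMap.comp_apply, LinearMap.lTensor, ← TensorProduct.map_comp]
    congr 2
    exact (CoalgHom.map_comp_comul (SCoalg.Hom.toCoalgHom ψ)).symm
  counit := by
    have h : (TensorProduct.rid k S.carrier).toLinearMap ∘ₗ
        LinearMap.lTensor S.carrier Coalgebra.counit ∘ₗ
        TensorProduct.map (SAlgf.Hom.toAlgHom φ).toLinearMap (SCoalg.lin ψ) =
        (SAlgf.Hom.toAlgHom φ).toLinearMap ∘ₗ (TensorProduct.rid k R.carrier).toLinearMap ∘ₗ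
        LinearMap.lTensor R.carrier Coalgebra.counit := by
      ext r a
      simp [SCoalg.lin]
    have h' := LinearMap.congr_fun h u
    simp only [LinearMap.comp_apply, LinearEquiv.coe_coe] at h'
    rw [h', hu.counit]
    simp

/-- The functor `A ↦ Sp* A`, where `(Sp* A)(R)` is the set of group-like elements of `R ⊗ A`. -/
def SpStar (k : Type u) [Field k] : SCoalg k ⥤ SFFunt k where
  obj A :=
    { obj := fun R => {u : R.carrier ⊗[k] A.carrier // IsGroupLike R A u}
      map := fun φ => ↾fun u => ⟨_, u.2.map φ (𝟙 A)⟩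
      map_id := fun R => by
        ext u
        exact LinearMap.congr_fun TensorProduct.map_id u.1
      map_comp := fun φ χ => by
        ext u
        exact LinearMap.congr_fun (TensorProduct.map_comp (SAlgf.Hom.toAlgHom χ).toLinearMap
          LinearMap.id (SAlgf.Hom.toAlgHom φ).toLinearMap LinearMap.id) u.1 }
  map ψ :=
    { app := fun R => ↾fun u => ⟨_, u.2.map (𝟙 R) ψ⟩
      naturality := fun R S φ => by
        ext u
        change (TensorProduct.map LinearMap.id (SCoalg.lin ψ) ∘ₗ
            TensorProduct.map (SAlgf.Hom.toAlgHom φ).toLinearMap LinearMap.id) u.1 =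
          (TensorProduct.map (SAlgf.Hom.toAlgHom φ).toLinearMap LinearMap.id ∘ₗ
            TensorProduct.map LinearMap.id (SCoalg.lin ψ)) u.1
        simp only [← TensorProduct.map_comp, LinearMap.comp_id, LinearMap.id_comp] }
  map_id A := by
    ext R u
    exact LinearMap.congr_fun TensorProduct.map_id u.1
  map_comp ψ χ := by
    ext R u
    exact LinearMap.congr_fun (TensorProduct.map_comp LinearMap.id (SCoalg.lin χ)
      LinearMap.id (SCoalg.lin ψ)) u.1

end SpStar

/-! ### Super-comodules, cotensor products and faithful flatness -/

/-- A right super-comodule over the super-coalgebra `B`. -/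
structure SComod {k : Type u} [Field k] (B : SCoalg k) where
  carrier : Type u
  [addCommGroup : AddCommGroup carrier]
  [module : Module k carrier]
  grading : ZMod 2 → Submodule k carrier
  [decomposition : DirectSum.Decomposition grading]
  coact : carrier →ₗ[k] carrier ⊗[k] B.carrier
  coact_isEven : IsEven grading (tensorGrading grading B.grading) coact
  coassoc : TensorProduct.assoc k carrier B.carrier B.carrier ∘ₗ
    coact.rTensor B.carrier ∘ₗ coact = LinearMap.lTensor carrier Coalgebra.comul ∘ₗ coact
  counit : TensorProduct.rid k carrier ∘ₗ LinearMap.lTensor carrier Coalgebra.counit ∘ₗ coact =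
    LinearMap.id

namespace SComod

attribute [instance] addCommGroup module decomposition

variable {k : Type u} [Field k] {B : SCoalg k}

/-- A morphism of super-comodules: a degree-preserving colinear map. -/
structure Hom (M N : SComod B) where
  lin : M.carrier →ₗ[k] N.carrier
  isEven : IsEven M.grading N.grading lin
  comm : N.coact ∘ₗ lin = lin.rTensor B.carrier ∘ₗ M.coact

end SComod

section Cotensor

variable {k : Type u} [Field k] {A B : SCoalg k}

/-- The cotensor product `M □_B N`, as a subspace of `M ⊗ N`, for a right coaction `ρ` on `M` and
a left coaction `σ` on `N`: the equalizer of `ρ ⊗ id` and `id ⊗ σ`. -/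
def cotensorSubmodule {M N C : Type u} [AddCommGroup M] [Module k M] [AddCommGroup N] [Module k N]
    [AddCommGroup C] [Module k C] (ρ : M →ₗ[k] M ⊗[k] C) (σ : N →ₗ[k] C ⊗[k] N) :
    Submodule k (M ⊗[k] N) :=
  LinearMap.eqLocus ((TensorProduct.assoc k M C N).toLinearMap ∘ₗ ρ.rTensor N) (σ.lTensor M)

/-- The left coaction of `B` on `A` induced by a morphism `ψ : A ⟶ B`. -/
def leftCoact (ψ : A ⟶ B) : A.carrier →ₗ[k] B.carrier ⊗[k] A.carrier :=
  (SCoalg.lin ψ).rTensor A.carrier ∘ₗ Coalgebra.comul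

/-- The space `M □_B A` underlying the pull-back of the super-comodule `M` along `ψ : A ⟶ B`. -/
def pullbackSpace (ψ : A ⟶ B) (M : SComod B) : Submodule k (M.carrier ⊗[k] A.carrier) :=
  cotensorSubmodule M.coact (leftCoact ψ)

/-- The map `g □_B A : M □_B A → N □_B A` induced by a morphism of super-comodules `g : M → N`. -/
def pullbackMap (ψ : A ⟶ B) {M N : SComod B} (g : M.Hom N) :
    pullbackSpace ψ M →ₗ[k] pullbackSpace ψ N :=
  (g.lin.rTensor A.carrier).restrict (fun x hx => by
    have h1 : (TensorProduct.assoc k N.carrier B.carrier A.carrier).toLinearMap ∘ₗ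
        N.coact.rTensor A.carrier ∘ₗ g.lin.rTensor A.carrier =
        g.lin.rTensor (B.carrier ⊗[k] A.carrier) ∘ₗ
        (TensorProduct.assoc k M.carrier B.carrier A.carrier).toLinearMap ∘ₗ
        M.coact.rTensor A.carrier := by
      rw [← LinearMap.rTensor_comp, g.comm, LinearMap.rTensor_comp, ← LinearMap.comp_assoc,
        ← LinearMap.comp_assoc]
      congr 1
      ext
      simp
    have h2 : (leftCoact ψ).lTensor N.carrier ∘ₗ g.lin.rTensor A.carrier =
        g.lin.rTensor (B.carrier ⊗[k] A.carrier) ∘ₗ (leftCoact ψ).lTensor M.carrier := by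
      rw [LinearMap.lTensor_comp_rTensor, LinearMap.rTensor_comp_lTensor]
    have hx' := (LinearMap.mem_eqLocus).1 hx
    refine (LinearMap.mem_eqLocus).2 ?_
    have h1' := LinearMap.congr_fun h1 x
    have h2' := LinearMap.congr_fun h2 x
    simp only [LinearMap.comp_apply] at h1' h2' hx' ⊢
    rw [h1', h2', hx'])

/-- `- □_B A` is faithfully exact: a sequence `L → M → N` of super-comodules over `B` is exact
if and only if `L □_B A → M □_B A → N □_B A` is. (Kernels and images of super-comodules are those
of the underlying vector spaces.) -/
def IsFaithfullyCoflat (ψ : A ⟶ B) : Prop :=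
  ∀ (L M N : SComod B) (g : L.Hom M) (h : M.Hom N),
    Function.Exact g.lin h.lin ↔ Function.Exact (pullbackMap ψ g) (pullbackMap ψ h)

end Cotensor

/-- A map `f : X ⟶ Y` of formal superschemes is faithfully flat if the pull-back functor
`f^* = - □_B A` is faithfully exact, where `X ≅ Sp* A`, `Y ≅ Sp* B` and `f` corresponds to the
morphism of super-coalgebras `ψ : A ⟶ B`. -/
def IsFaithfullyFlat {k : Type u} [Field k] {X Y : FormalSuperscheme k} (f : X ⟶ Y) : Prop :=
  ∃ (A B : SCoalg k) (eX : X.obj ≅ (SpStar k).obj A) (eY : Y.obj ≅ (SpStar k).obj B) (ψ : A ⟶ B),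
    f.hom ≫ eY.hom = eX.hom ≫ (SpStar k).map ψ ∧ IsFaithfullyCoflat ψ

end FormalSuper

end

noncomputable section

namespace FormalSuper

/-! ### Gradings in characteristic different from `2` as parity involutions. -/

section Parity

variable {k : Type u} [Field k]
variable {V W : Type u} [AddCommGroup V] [Module k V] [AddCommGroup W] [Module k W]

/-! Since `2` is invertible, a `ZMod 2`-grading amounts to a parity involution `σ`, and
supercommutativity becomes the identity `2xy = y(x + σx) + σ(y)(x - σx)`, free of homogeneous
components. The linear dual `A*` of a super-coalgebra, with the opposite convolution product,
satisfies this identity, and the `R`-points of `Sp* A` are the even algebra homomorphisms `A* → R`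
that only see the restriction of forms to some finite-dimensional subspace (`isGroupLike_iff`,
`exists_evalPt_eq`). So `Sp* A` is the directed union of the `SSpf D*` over the finite-dimensional
super-subcoalgebras `D` of `A` (`FinSub.exists_le`).

The fibre product is the functor of pairs of points with equal image in `Y`; on a chart it is
represented by a push-out of superalgebras (`isFormalSuperscheme_kernelPair`).

Faithful flatness enters through the exactness of `A □_B A → A → B → 0`, where the first map is `id
⊗ ε - ε ⊗ id`. After cotensoring with `A` the comultiplication provides preimages, so the sequence
becomes exact, and faithful exactness reflects this (`surjective_of_isFaithfullyCoflat`,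
`exists_projDiff_eq`).

Now let `g : Sp* A ⟶ Z` agree on points with the same image in `Sp* B`. On `D'` it is given by some
`φ : C ⟶ D'*`, with `C` a chart of `Z`, and the two maps from `D'*` to `D'* ⊗ D'*` over `ψ(D')*`
agree on the image of `φ`. A form `X` on which they agree kills `(id ⊗ ε - ε ⊗ id) w` for each `w`
in both `A □_B A` and `D' ⊗ D'`. If `D'` is large compared with `D`, then `X` kills `ker ψ ∩ D`, so
`X` restricted to `D` comes from a form on `ψ(D)`. Hence `g` on `D` descends to a point of `Z` over
`ψ(D)*` (`exists_descended_point`). As `ψ(D)* → D*` is injective and formal superschemes preserve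
injections (`IsFormalSuperscheme.map_injective`), this point is unique, so the points are
compatible. As `ψ` is surjective, the `ψ(D)` exhaust `B`, and the points glue to the required
morphism (`existsUnique_descent`). -/

theorem zmod_two_cases (i : ZMod 2) : i = 0 ∨ i = 1 := by
  revert i
  decide

/-- The sign `(-1)^i` as a scalar. -/
def sgn (k : Type u) [Field k] (i : ZMod 2) : k := if i = 0 then 1 else -1

@[simp] theorem sgn_zero : sgn k 0 = 1 := rfl

@[simp] theorem sgn_one : sgn k 1 = -1 := rfl

theorem sgn_add (i j : ZMod 2) : sgn k (i + j) = sgn k i * sgn k j := by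
  rcases zmod_two_cases i with rfl | rfl <;> rcases zmod_two_cases j with rfl | rfl <;>
    simp [show (1 : ZMod 2) + 1 = 0 from rfl]

theorem sgn_mul_self (i : ZMod 2) : sgn k i * sgn k i = 1 := by
  rcases zmod_two_cases i with rfl | rfl <;> simp

/-- The parity involution of a super vector space. -/
def par (𝒱 : ZMod 2 → Submodule k V) [DirectSum.Decomposition 𝒱] : V →ₗ[k] V :=
  (DirectSum.toModule k (ZMod 2) V fun i => sgn k i • (𝒱 i).subtype) ∘ₗ
    (DirectSum.decomposeLinearEquiv 𝒱).toLinearMap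

section

variable (𝒱 : ZMod 2 → Submodule k V) [DirectSum.Decomposition 𝒱]
  (𝒲 : ZMod 2 → Submodule k W) [DirectSum.Decomposition 𝒲]

theorem par_of_mem {i : ZMod 2} {v : V} (hv : v ∈ 𝒱 i) : par 𝒱 v = sgn k i • v := by
  lift v to 𝒱 i using hv
  simp [par]

theorem par_par (v : V) : par 𝒱 (par 𝒱 v) = v := by
  induction v using DirectSum.Decomposition.inductionOn 𝒱 with
  | zero => simp
  | add a b ha hb => simp [ha, hb]
  | homogeneous v => simp [par_of_mem 𝒱 v.2, smul_smul, sgn_mul_self]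

theorem exists_even_add_odd (v : V) : ∃ a ∈ 𝒱 0, ∃ b ∈ 𝒱 1, v = a + b := by
  induction v using DirectSum.Decomposition.inductionOn 𝒱 with
  | zero => exact ⟨0, zero_mem _, 0, zero_mem _, by simp⟩
  | add x y hx hy =>
    obtain ⟨a, ha, b, hb, rfl⟩ := hx
    obtain ⟨c, hc, d, hd, rfl⟩ := hy
    exact ⟨a + c, add_mem ha hc, b + d, add_mem hb hd, by abel⟩
  | @homogeneous i v =>
    rcases zmod_two_cases i with rfl | rfl
    · exact ⟨v, v.2, 0, zero_mem _, by simp⟩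
    · exact ⟨0, zero_mem _, v, v.2, by simp⟩

/-- The component of the wrong parity is killed by `2`. Only spanning is required, not directness of
the sum, so this applies to `tensorGrading`, for which no decomposition is constructed. -/
theorem mem_of_involution [NeZero (2 : k)] {𝒱 : ZMod 2 → Submodule k V} {σ : V →ₗ[k] V}
    (hσ : ∀ i, ∀ v ∈ 𝒱 i, σ v = sgn k i • v) (hs : ∀ v, ∃ a ∈ 𝒱 0, ∃ b ∈ 𝒱 1, v = a + b)
    {i : ZMod 2} {v : V} (h : σ v = sgn k i • v) : v ∈ 𝒱 i := by
  have h2 : (2 : k) ≠ 0 := two_ne_zero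
  obtain ⟨a, ha, b, hb, rfl⟩ := hs v
  rw [map_add, hσ 0 a ha, hσ 1 b hb] at h
  rcases zmod_two_cases i with rfl | rfl
  · have : (2 : k) • b = 0 := by
      simp only [sgn_zero, sgn_one] at h
      linear_combination (norm := module) (-1 : k) • h
    rw [smul_eq_zero_iff_right h2] at this
    simpa [this] using ha
  · have : (2 : k) • a = 0 := by
      simp only [sgn_zero, sgn_one] at h
      linear_combination (norm := module) (1 : k) • h
    rw [smul_eq_zero_iff_right h2] at this
    simpa [this] using hb

theorem mem_iff_par [NeZero (2 : k)] {i : ZMod 2} {v : V} :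
    v ∈ 𝒱 i ↔ par 𝒱 v = sgn k i • v :=
  ⟨par_of_mem 𝒱, mem_of_involution (fun _ _ => par_of_mem 𝒱) (exists_even_add_odd 𝒱)⟩

theorem isEven_iff [NeZero (2 : k)] {f : V →ₗ[k] W} :
    IsEven 𝒱 𝒲 f ↔ ∀ v, par 𝒲 (f v) = f (par 𝒱 v) := by
  constructor
  · intro h v
    obtain ⟨a, ha, b, hb, rfl⟩ := exists_even_add_odd 𝒱 v
    simp [par_of_mem 𝒱 ha, par_of_mem 𝒱 hb, par_of_mem 𝒲 (h _ _ ha), par_of_mem 𝒲 (h _ _ hb)]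
  · intro h i v hv
    rw [mem_iff_par 𝒲, h, par_of_mem 𝒱 hv, map_smul]

theorem par_unique {σ : V →ₗ[k] V} (hσ : ∀ i, ∀ v ∈ 𝒱 i, σ v = sgn k i • v) : par 𝒱 = σ := by
  ext v
  obtain ⟨a, ha, b, hb, rfl⟩ := exists_even_add_odd 𝒱 v
  simp [par_of_mem 𝒱 ha, par_of_mem 𝒱 hb, hσ _ _ ha, hσ _ _ hb]

theorem mem_tensorGrading_iff [NeZero (2 : k)] {i : ZMod 2} {x : V ⊗[k] W} :
    x ∈ tensorGrading 𝒱 𝒲 i ↔ TensorProduct.map (par 𝒱) (par 𝒲) x = sgn k i • x := by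
  have key : ∀ i, ∀ x ∈ tensorGrading 𝒱 𝒲 i,
      TensorProduct.map (par 𝒱) (par 𝒲) x = sgn k i • x := by
    intro n x hx
    have : tensorGrading 𝒱 𝒲 n ≤
        LinearMap.eqLocus (TensorProduct.map (par 𝒱) (par 𝒲)) (sgn k n • LinearMap.id) := by
      refine iSup_le fun i => Submodule.map₂_le.2 fun v hv w hw => ?_
      rw [LinearMap.mem_eqLocus]
      simp only [TensorProduct.mk_apply, TensorProduct.map_tmul, par_of_mem 𝒱 hv,
        par_of_mem 𝒲 hw, LinearMap.smul_apply, LinearMap.id_apply]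
      rw [TensorProduct.smul_tmul_smul, ← sgn_add, add_sub_cancel]
    exact this hx
  refine ⟨key i x, mem_of_involution (σ := TensorProduct.map (par 𝒱) (par 𝒲)) key ?_⟩
  clear x
  intro x
  have mk : ∀ (i j n : ZMod 2) {v : V} {w : W}, i + j = n → v ∈ 𝒱 i → w ∈ 𝒲 j →
      v ⊗ₜ[k] w ∈ tensorGrading 𝒱 𝒲 n := by
    rintro i j _ v w rfl hv hw
    refine Submodule.mem_iSup_of_mem i
      (Submodule.apply_mem_map₂ (TensorProduct.mk k V W) hv ?_)
    rwa [add_sub_cancel_left]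
  induction x with
  | zero => exact ⟨0, zero_mem _, 0, zero_mem _, by simp⟩
  | add x y hx hy =>
    obtain ⟨a, ha, b, hb, rfl⟩ := hx
    obtain ⟨c, hc, d, hd, rfl⟩ := hy
    exact ⟨a + c, add_mem ha hc, b + d, add_mem hb hd, by abel⟩
  | tmul v w =>
    obtain ⟨a, ha, b, hb, rfl⟩ := exists_even_add_odd 𝒱 v
    obtain ⟨c, hc, d, hd, rfl⟩ := exists_even_add_odd 𝒲 w
    have h00 := mk 0 0 0 (by decide) ha hc
    have h01 := mk 0 1 1 (by decide) ha hd
    have h10 := mk 1 0 1 (by decide) hb hc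
    have h11 := mk 1 1 0 (by decide) hb hd
    refine ⟨_, add_mem h00 h11, _, add_mem h01 h10, ?_⟩
    simp only [TensorProduct.add_tmul, TensorProduct.tmul_add]
    abel

theorem isEven_tensor_iff [NeZero (2 : k)] {U : Type u} [AddCommGroup U] [Module k U]
    (𝒰 : ZMod 2 → Submodule k U) [DirectSum.Decomposition 𝒰] {f : U →ₗ[k] V ⊗[k] W} :
    IsEven 𝒰 (tensorGrading 𝒱 𝒲) f ↔
      ∀ u, TensorProduct.map (par 𝒱) (par 𝒲) (f u) = f (par 𝒰 u) := by
  constructor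
  · intro h u
    obtain ⟨a, ha, b, hb, rfl⟩ := exists_even_add_odd 𝒰 u
    simp only [map_add, par_of_mem 𝒰 ha, par_of_mem 𝒰 hb,
      (mem_tensorGrading_iff 𝒱 𝒲).1 (h _ _ ha), (mem_tensorGrading_iff 𝒱 𝒲).1 (h _ _ hb), map_smul]
  · intro h i v hv
    rw [mem_tensorGrading_iff 𝒱 𝒲, h, par_of_mem 𝒰 hv, map_smul]

/-- The even and odd parts of `v` are half of `v + par v` and of `v - par v`, and `w` changes by its
parity involution when it passes the odd part. This removes homogeneous components from the sign
rule. -/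
theorem two_smul_twist_tmul (v : V) (w : W) :
    (2 : k) • twist 𝒱 𝒲 (v ⊗ₜ w) =
      w ⊗ₜ (v + par 𝒱 v) + par 𝒲 w ⊗ₜ (v - par 𝒱 v) := by
  obtain ⟨a, ha, b, hb, rfl⟩ := exists_even_add_odd 𝒱 v
  obtain ⟨c, hc, d, hd, rfl⟩ := exists_even_add_odd 𝒲 w
  simp only [TensorProduct.add_tmul, TensorProduct.tmul_add, map_add, twist_tmul 𝒱 𝒲 ha hc,
    twist_tmul 𝒱 𝒲 ha hd, twist_tmul 𝒱 𝒲 hb hc, twist_tmul 𝒱 𝒲 hb hd, par_of_mem 𝒱 ha,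
    par_of_mem 𝒱 hb, par_of_mem 𝒲 hc, par_of_mem 𝒲 hd, sgn_zero, sgn_one, one_smul, neg_smul,
    TensorProduct.neg_tmul, TensorProduct.tmul_neg, TensorProduct.tmul_sub, mul_zero,
    uzpow_zero, mul_one, uzpow_one, Units.neg_smul, two_smul]
  abel

end

/-- The `ZMod 2`-grading by the eigenspaces of an involution. -/
def invGrading (σ : V →ₗ[k] V) (i : ZMod 2) : Submodule k V :=
  LinearMap.eqLocus σ (sgn k i • LinearMap.id)

theorem mem_invGrading {σ : V →ₗ[k] V} {i : ZMod 2} {v : V} :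
    v ∈ invGrading σ i ↔ σ v = sgn k i • v := Iff.rfl

/-- The eigenspaces of an involution decompose the space. -/
@[reducible]
def invDecomposition [NeZero (2 : k)] (σ : V →ₗ[k] V) (hσ : ∀ v, σ (σ v) = v) :
    DirectSum.Decomposition (invGrading σ) :=
  have h2 : (2 : k) ≠ 0 := two_ne_zero
  have hmem : ∀ i v, (2 : k)⁻¹ • (v + sgn k i • σ v) ∈ invGrading σ i := by
    intro i v
    rw [mem_invGrading]
    simp only [map_smul, map_add, hσ, smul_add, smul_smul, mul_left_comm (sgn k i) (2⁻¹ : k),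
      sgn_mul_self, mul_one]
    rw [add_comm, mul_comm]
  DirectSum.Decomposition.ofLinearMap (ℳ := invGrading σ)
    (∑ i : ZMod 2, DirectSum.lof k (ZMod 2) (fun i => invGrading σ i) i ∘ₗ
      LinearMap.codRestrict (invGrading σ i)
        ((2 : k)⁻¹ • (LinearMap.id + sgn k i • σ)) (hmem i))
    (by
      ext v
      simp only [LinearMap.comp_apply, LinearMap.sum_apply, map_sum,
        DirectSum.coeLinearMap_lof, LinearMap.codRestrict_apply]
      have : (Finset.univ : Finset (ZMod 2)) = {0, 1} := rfl
      rw [this, Finset.sum_pair (by decide)]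
      simp only [sgn_zero, sgn_one, LinearMap.smul_apply, LinearMap.add_apply, LinearMap.id_apply,
        ← smul_add, one_smul, neg_smul, LinearMap.neg_apply]
      rw [show v + σ v + (v + -σ v) = (2 : k) • v by rw [two_smul]; abel, smul_smul,
        inv_mul_cancel₀ h2, one_smul])
    (by
      ext i ⟨v, hv⟩ : 2
      rw [mem_invGrading] at hv
      simp only [LinearMap.comp_apply, LinearMap.sum_apply,
        DirectSum.coeLinearMap_lof, LinearMap.id_apply]
      rw [Finset.sum_eq_single i]
      · congr 1
        ext
        simp only [LinearMap.codRestrict_apply, LinearMap.smul_apply, LinearMap.add_apply,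
          LinearMap.id_apply, hv, smul_smul, sgn_mul_self, one_smul]
        rw [← two_smul k v, smul_smul, inv_mul_cancel₀ h2, one_smul]
      · intro j _ hj
        have hs : sgn k j * sgn k i = -1 := by
          rcases zmod_two_cases i with rfl | rfl <;> rcases zmod_two_cases j with rfl | rfl <;>
            simp_all
        rw [show LinearMap.codRestrict (invGrading σ j) ((2 : k)⁻¹ • (LinearMap.id + sgn k j • σ))
          (hmem j) v = 0 by ext; simp [hv, smul_smul, mul_assoc, hs], map_zero]
      · simp)

theorem par_invGrading [NeZero (2 : k)] (σ : V →ₗ[k] V)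
    [DirectSum.Decomposition (invGrading σ)] : par (invGrading σ) = σ :=
  par_unique _ fun _ _ h => h

end Parity

section SAlgfParity

variable {k : Type u} [Field k]

namespace SAlgf

variable (R : SAlgf k)

/-- The parity involution of a superalgebra. -/
abbrev par : R.carrier →ₗ[k] R.carrier := FormalSuper.par R.grading

theorem par_one : R.par 1 = 1 := by
  simp [par_of_mem R.grading (SetLike.GradedOne.one_mem (A := R.grading))]

theorem par_mul (x y : R.carrier) : R.par (x * y) = R.par x * R.par y := by
  obtain ⟨a, ha, b, hb, rfl⟩ := exists_even_add_odd R.grading x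
  obtain ⟨c, hc, d, hd, rfl⟩ := exists_even_add_odd R.grading y
  have h : ∀ {i j : ZMod 2} {x y : R.carrier}, x ∈ R.grading i → y ∈ R.grading j →
      R.par (x * y) = R.par x * R.par y := by
    intro i j x y hx hy
    rw [par_of_mem R.grading (SetLike.GradedMul.mul_mem hx hy), par_of_mem R.grading hx,
      par_of_mem R.grading hy, sgn_add, smul_mul_smul_comm]
  simp only [add_mul, mul_add, map_add, h ha hc, h ha hd, h hb hc, h hb hd]

theorem odd_anticomm {x y : R.carrier} (hx : x ∈ R.grading 1) (hy : y ∈ R.grading 1) :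
    x * y = -(y * x) := by
  have h := R.odd_sq (x + y) (add_mem hx hy)
  rw [add_mul, mul_add, mul_add, R.odd_sq x hx, R.odd_sq y hy, zero_add, add_zero] at h
  exact eq_neg_of_add_eq_zero_left h

theorem mul_eq_of_odd {x : R.carrier} (hx : x ∈ R.grading 1) (y : R.carrier) :
    x * y = R.par y * x := by
  obtain ⟨c, hc, d, hd, rfl⟩ := exists_even_add_odd R.grading y
  simp only [mul_add, add_mul, map_add, par_of_mem R.grading hc, par_of_mem R.grading hd, sgn_zero,
    sgn_one, one_smul, neg_smul, neg_mul, ← R.even_central c hc x, R.odd_anticomm hx hd]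

theorem mul_comm_of_homogeneous {i j : ZMod 2} {x y : R.carrier} (hx : x ∈ R.grading i)
    (hy : y ∈ R.grading j) : x * y = (-1 : ℤˣ) ^ (j * i) • (y * x) := by
  rcases zmod_two_cases i with rfl | rfl
  · rw [R.even_central x hx, mul_zero, uzpow_zero, one_smul]
  · rcases zmod_two_cases j with rfl | rfl
    · rw [R.even_central y hy, zero_mul, uzpow_zero, one_smul]
    · rw [R.odd_anticomm hx hy, mul_one, uzpow_one, Units.neg_smul, one_smul]

/-- A finite-dimensional supercommutative superalgebra, from its parity involution. -/
def ofInvolution [NeZero (2 : k)] (E : Type u) [Ring E] [Algebra k E] [Module.Finite k E]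
    (σ : E →ₐ[k] E) (hσ : ∀ x, σ (σ x) = x)
    (hc : ∀ x y, (2 : k) • (x * y) = y * (x + σ x) + σ y * (x - σ x)) : SAlgf k where
  carrier := E
  grading := invGrading σ.toLinearMap
  gradedAlgebra :=
    { invDecomposition σ.toLinearMap hσ with
      one_mem := by simp [mem_invGrading]
      mul_mem := by
        intro i j x y hx hy
        rw [mem_invGrading] at *
        simp only [AlgHom.toLinearMap_apply] at *
        rw [map_mul, hx, hy, smul_mul_smul_comm, sgn_add] }
  even_central x hx y := by
    have h2 : (2 : k) ≠ 0 := two_ne_zero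
    have hx : σ x = x := by simpa [mem_invGrading] using hx
    have h := hc x y
    rw [hx, sub_self, mul_zero, add_zero, ← two_smul k x, mul_smul_comm] at h
    exact (smul_right_inj h2).1 h
  odd_sq x hx := by
    have h2 : (2 : k) ≠ 0 := two_ne_zero
    have hx : σ x = -x := by simpa [mem_invGrading] using hx
    have h := hc x x
    rw [hx, add_neg_cancel, mul_zero, zero_add, sub_neg_eq_add, neg_mul, mul_add, ← two_smul k,
      eq_neg_iff_add_eq_zero, ← two_smul k, smul_smul] at h
    exact (smul_eq_zero_iff_right (mul_ne_zero h2 h2)).1 h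

theorem par_ofInvolution [NeZero (2 : k)] {E : Type u} [Ring E] [Algebra k E] [Module.Finite k E]
    (σ : E →ₐ[k] E) (hσ : ∀ x, σ (σ x) = x)
    (hc : ∀ x y, (2 : k) • (x * y) = y * (x + σ x) + σ y * (x - σ x)) (x : E) :
    (ofInvolution E σ hσ hc).par x = σ x :=
  LinearMap.congr_fun
    (par_unique (ofInvolution E σ hσ hc).grading (σ := σ.toLinearMap) fun _ _ h => h) x

/-- The parity involution of a superalgebra, as an algebra homomorphism. -/
def parHom : R.carrier →ₐ[k] R.carrier :=
  AlgHom.ofLinearMap R.par R.par_one R.par_mul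

/-- An algebra homomorphism commuting with the parity involutions is a morphism. -/
def homMk [NeZero (2 : k)] {R S : SAlgf k} (φ : R.carrier →ₐ[k] S.carrier)
    (h : ∀ x, S.par (φ x) = φ (R.par x)) : R ⟶ S :=
  ⟨φ, (isEven_iff _ _).2 h⟩

theorem par_hom [NeZero (2 : k)] {R S : SAlgf k} (φ : R ⟶ S) (x : R.carrier) :
    S.par (Hom.toAlgHom φ x) = Hom.toAlgHom φ (R.par x) :=
  (isEven_iff _ _).1 φ.isEven x

end SAlgf

end SAlgfParity

end FormalSuper

namespace FormalSuper

/-! ### Formal superschemes as directed unions of charts. -/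

section Charts

variable {k : Type u} [Field k]

namespace SAlgf

@[simp]
theorem comp_toAlgHom_apply {R S T : SAlgf k} (f : R ⟶ S) (g : S ⟶ T) (x : R.carrier) :
    Hom.toAlgHom (f ≫ g) x = Hom.toAlgHom g (Hom.toAlgHom f x) := rfl

theorem hom_ext' {R S : SAlgf k} {f g : R ⟶ S}
    (h : ∀ x, Hom.toAlgHom f x = Hom.toAlgHom g x) : f = g :=
  Hom.ext (AlgHom.ext h)

theorem epi_of_surjective {R S T : SAlgf k} {f : R ⟶ S}
    (hf : Function.Surjective (Hom.toAlgHom f)) {g h : S ⟶ T} (e : f ≫ g = f ≫ h) : g = h :=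
  hom_ext' fun x => by
    obtain ⟨y, rfl⟩ := hf x
    rw [← comp_toAlgHom_apply, e, comp_toAlgHom_apply]

end SAlgf

/-- A presentation of a formal super functor as a directed union of finite affine superschemes:
`ξ j` is a point of `X` corresponding to the inclusion of `SSpf (A j)`. -/
structure Charts (X : SFFunt k) (J : Type u) [PartialOrder J] where
  A : J ⥤ (SAlgf k)ᵒᵖ
  ξ : ∀ j, X.obj (A.obj j).unop
  surj : ∀ (l m : J) (u : l ⟶ m), Function.Surjective (SAlgf.Hom.toAlgHom (A.map u).unop)
  compat : ∀ (l m : J) (u : l ⟶ m), X.map (A.map u).unop (ξ m) = ξ l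
  mono : ∀ (j : J) (R : SAlgf k) (s t : (A.obj j).unop ⟶ R),
    X.map s (ξ j) = X.map t (ξ j) → s = t
  cover : ∀ (R : SAlgf k) (x : X.obj R), ∃ (j : J) (s : (A.obj j).unop ⟶ R), X.map s (ξ j) = x

/-- The points `ξ j` are the Yoneda elements of the colimit cocone. Colimits of functors are
pointwise, so points equal in `X` become equal at a later stage; surjective transition maps are
epimorphisms, so they were already equal, which gives `mono`. -/
theorem IsFormalSuperscheme.exists_charts {X : SFFunt k} (hX : IsFormalSuperscheme k X) :
    ∃ (J : Type u) (_ : PartialOrder J) (_ : Nonempty J) (_ : IsDirectedOrder J),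
      Nonempty (Charts X J) := by
  obtain ⟨J, _, _, _, A, hA, ⟨e⟩⟩ := hX
  let F := A ⋙ SSpf k
  let c : Cocone F := (colimit.cocone F).extend e.inv
  have hc : IsColimit c := IsColimit.ofIsoColimit (colimit.isColimit F)
    (Cocone.ext e.symm fun _ => rfl)
  have hcR (R : SAlgf k) := isColimitOfPreserves ((evaluation _ _).obj R) hc
  let ξ : ∀ j, X.obj (A.obj j).unop := fun j => (c.ι.app j).app _ (𝟙 (A.obj j).unop)
  have key : ∀ j R (s : (A.obj j).unop ⟶ R), X.map s (ξ j) = (c.ι.app j).app R s := by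
    intro j R s
    have := ConcreteCategory.congr_hom ((c.ι.app j).naturality s) (𝟙 (A.obj j).unop)
    refine Eq.trans this.symm ?_
    change (c.ι.app j).app R (𝟙 _ ≫ s) = _
    rw [Category.id_comp]
  refine ⟨J, ‹_›, ‹_›, ‹_›, ⟨{ A := A, ξ := ξ, surj := hA, compat := ?_, mono := ?_, cover := ?_ }⟩⟩
  · intro l m u
    rw [key]
    have := ConcreteCategory.congr_hom (NatTrans.congr_app (c.w u) _) (𝟙 (A.obj l).unop)
    refine Eq.trans ?_ this
    change _ = (c.ι.app m).app _ ((A.map u).unop ≫ 𝟙 _)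
    rw [Category.comp_id]
  · intro j R s t h
    rw [key, key] at h
    obtain ⟨l, f, hf⟩ := (Types.FilteredColimit.isColimit_eq_iff' (hcR R) s t).1 h
    exact SAlgf.epi_of_surjective (hA j l f) hf
  · intro R x
    obtain ⟨j, s, hs⟩ := Types.jointly_surjective_of_isColimit (hcR R) x
    exact ⟨j, s, (key j R s).trans hs⟩

theorem Charts.isFormalSuperscheme {X : SFFunt k} {J : Type u} [PartialOrder J] [Nonempty J]
    [IsDirectedOrder J] (C : Charts X J) : IsFormalSuperscheme k X := by
  let c : Cocone (C.A ⋙ SSpf k) :=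
    { pt := X
      ι :=
        { app := fun j => coyonedaEquiv.symm (C.ξ j)
          naturality := fun j l u => by
            ext R s
            change X.map ((C.A.map u).unop ≫ s) (C.ξ l) = X.map s (C.ξ j)
            rw [← C.compat j l u, X.map_comp]
            rfl } }
  have hc : IsColimit c := by
    refine evaluationJointlyReflectsColimits _ fun R => ?_
    refine Types.FilteredColimit.isColimitOf' _ _ (fun x => ?_) (fun j s t h => ?_)
    · obtain ⟨j, s, rfl⟩ := C.cover R x
      exact ⟨j, s, rfl⟩
    · exact ⟨j, 𝟙 j, by rw [C.mono j R s t h]⟩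
  exact ⟨J, inferInstance, inferInstance, inferInstance, C.A, C.surj,
    ⟨hc.coconePointUniqueUpToIso (colimit.isColimit _)⟩⟩

/-- Every point of a formal superscheme is obtained from a universal point of a chart. -/
theorem IsFormalSuperscheme.exists_chart {X : SFFunt k} (hX : IsFormalSuperscheme k X)
    {R : SAlgf k} (x : X.obj R) :
    ∃ (A : SAlgf k) (ξ : X.obj A) (s : A ⟶ R), X.map s ξ = x ∧
      ∀ (S : SAlgf k) (t u : A ⟶ S), X.map t ξ = X.map u ξ → t = u := by
  obtain ⟨J, _, _, _, ⟨C⟩⟩ := hX.exists_charts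
  obtain ⟨j, s, hs⟩ := C.cover R x
  exact ⟨_, C.ξ j, s, hs, C.mono j⟩

/-- By directedness two points lie in a common chart, where they are homomorphisms into `R`, and an
injective `i` can be cancelled. This gives uniqueness and compatibility of descended points. -/
theorem IsFormalSuperscheme.map_injective {X : SFFunt k} (hX : IsFormalSuperscheme k X)
    {R S : SAlgf k} (i : R ⟶ S) (hi : Function.Injective (SAlgf.Hom.toAlgHom i)) :
    Function.Injective (X.map i) := by
  obtain ⟨J, _, _, _, ⟨C⟩⟩ := hX.exists_charts
  intro x y h
  obtain ⟨j, s, rfl⟩ := C.cover R x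
  obtain ⟨l, t, rfl⟩ := C.cover R y
  obtain ⟨m, hjm, hlm⟩ := exists_ge_ge j l
  rw [← C.compat j m (homOfLE hjm), ← C.compat l m (homOfLE hlm)] at h ⊢
  rw [← comp_apply, ← comp_apply, ← Functor.map_comp, ← Functor.map_comp] at h ⊢
  rw [← comp_apply, ← comp_apply, ← Functor.map_comp, ← Functor.map_comp] at h
  have := C.mono _ _ _ _ h
  refine congrArg (fun r => X.map r (C.ξ m)) ?_
  refine SAlgf.hom_ext' fun x => hi ?_
  rw [← SAlgf.comp_toAlgHom_apply, ← SAlgf.comp_toAlgHom_apply, Category.assoc, Category.assoc,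
    this]

theorem isFormalSuperscheme_coyoneda (R : SAlgf k) :
    IsFormalSuperscheme k ((SSpf k).obj (Opposite.op R)) := by
  refine Charts.isFormalSuperscheme (J := PUnit.{u+1})
    { A := (Functor.const _).obj (Opposite.op R)
      ξ := fun _ => 𝟙 R
      surj := fun _ _ _ x => ⟨x, rfl⟩
      compat := fun _ _ _ => rfl
      mono := fun _ S s t h => ?_
      cover := fun S s => ⟨⟨⟩, s, Category.id_comp (X := R) s⟩ }
  change 𝟙 R ≫ s = 𝟙 R ≫ t at h
  rwa [Category.id_comp, Category.id_comp] at h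

end Charts

end FormalSuper

namespace FormalSuper

/-! ### Quotients, tensor products and push-outs of superalgebras. -/

namespace SAlgf

variable {k : Type u} [Field k]

/-- A quotient of a supercommutative superalgebra, of arbitrary dimension, by a homogeneous ideal
of finite codimension. -/
theorem exists_quotient [NeZero (2 : k)] {E : Type u} [Ring E] [Algebra k E] (σ : E →ₐ[k] E)
    (hσ : ∀ x, σ (σ x) = x)
    (hc : ∀ x y, (2 : k) • (x * y) = y * (x + σ x) + σ y * (x - σ x))
    (I : Ideal E) [I.IsTwoSided] (hI : ∀ x ∈ I, σ x ∈ I) [Module.Finite k (E ⧸ I)] :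
    ∃ (Q : SAlgf k) (q : E →ₐ[k] Q.carrier), Function.Surjective q ∧ (∀ x, q x = 0 ↔ x ∈ I) ∧
      ∀ x, Q.par (q x) = q (σ x) := by
  let τ : E ⧸ I →ₐ[k] E ⧸ I := Ideal.quotientMapₐ I σ hI
  have hτ : ∀ x, τ (Ideal.Quotient.mkₐ k I x) = Ideal.Quotient.mkₐ k I (σ x) := fun _ => rfl
  have hs := Ideal.Quotient.mkₐ_surjective k I
  refine ⟨ofInvolution (E ⧸ I) τ (fun x => ?_) (fun x y => ?_), Ideal.Quotient.mkₐ k I, hs,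
    fun x => Ideal.Quotient.eq_zero_iff_mem, fun x => par_ofInvolution _ _ _ _⟩
  · obtain ⟨x, rfl⟩ := hs x
    rw [hτ, hτ, hσ]
  · obtain ⟨x, rfl⟩ := hs x
    obtain ⟨y, rfl⟩ := hs y
    rw [hτ, hτ, ← map_mul, ← map_smul, hc]
    simp only [map_add, map_mul, map_sub]

theorem exists_lift {E F R : Type*} [Ring E] [Algebra k E] [Ring F] [Algebra k F] [Ring R]
    [Algebra k R] (q : E →ₐ[k] F) (hq : Function.Surjective q) (φ : E →ₐ[k] R)
    (h : ∀ x, q x = 0 → φ x = 0) : ∃ f : F →ₐ[k] R, ∀ x, f (q x) = φ x := by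
  have key : ∀ x y, q x = q y → φ x = φ y := fun x y hxy => by
    rw [← sub_eq_zero, ← map_sub]
    exact h _ (by rw [map_sub, hxy, sub_self])
  have hg : ∀ x, φ (Function.surjInv hq (q x)) = φ x := fun x =>
    key _ _ (Function.surjInv_eq hq _)
  refine ⟨{ toFun := fun y => φ (Function.surjInv hq y)
            map_one' := ?_, map_zero' := ?_, map_mul' := ?_, map_add' := ?_, commutes' := ?_ }, hg⟩
  · rw [← map_one q, hg, map_one]
  · intro x y
    obtain ⟨x, rfl⟩ := hq x
    obtain ⟨y, rfl⟩ := hq y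
    simp only [← map_mul, hg]
  · change φ (Function.surjInv hq 0) = 0
    rw [← map_zero q, hg, map_zero]
  · intro x y
    obtain ⟨x, rfl⟩ := hq x
    obtain ⟨y, rfl⟩ := hq y
    change φ (Function.surjInv hq (q x + q y)) = φ (Function.surjInv hq (q x)) +
      φ (Function.surjInv hq (q y))
    simp only [← map_add, hg]
  · intro r
    rw [← AlgHom.commutes q, hg, AlgHom.commutes]

section Tensor

variable (E₁ E₂ : SAlgf k)

/-- The tensor product of superalgebras. -/
abbrev Tensor : Type u := GradedTensorProduct k E₁.grading E₂.grading

/-- The inclusion of the first factor into the tensor product. -/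
abbrev tensorInl : E₁.carrier →ₐ[k] Tensor E₁ E₂ :=
  GradedTensorProduct.includeLeft E₁.grading E₂.grading

/-- The inclusion of the second factor into the tensor product. -/
abbrev tensorInr : E₂.carrier →ₐ[k] Tensor E₁ E₂ :=
  GradedTensorProduct.includeRight E₁.grading E₂.grading

variable {E₁ E₂}

theorem tensorInl_mul_tensorInr (a : E₁.carrier) (b : E₂.carrier) :
    tensorInl E₁ E₂ a * tensorInr E₁ E₂ b =
      GradedTensorProduct.of k E₁.grading E₂.grading (a ⊗ₜ b) :=
  GradedTensorProduct.tmul_one_mul_one_tmul _ _ a b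

theorem tensor_induction {p : Tensor E₁ E₂ → Prop} (h0 : p 0) (ha : ∀ x y, p x → p y → p (x + y))
    (h : ∀ i j, ∀ a ∈ E₁.grading i, ∀ b ∈ E₂.grading j,
      p (tensorInl E₁ E₂ a * tensorInr E₁ E₂ b)) (x) : p x := by
  have key : ∀ y : E₁.carrier ⊗[k] E₂.carrier,
      p (GradedTensorProduct.of k E₁.grading E₂.grading y) := by
    intro y
    induction y with
    | zero => simpa using h0
    | add x y hx hy => rw [map_add]; exact ha _ _ hx hy
    | tmul a b =>
      rw [← tensorInl_mul_tensorInr]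
      obtain ⟨a₀, h₀, a₁, h₁, rfl⟩ := exists_even_add_odd E₁.grading a
      obtain ⟨b₀, k₀, b₁, k₁, rfl⟩ := exists_even_add_odd E₂.grading b
      rw [map_add, map_add, add_mul, mul_add, mul_add]
      exact ha _ _ (ha _ _ (h _ _ _ h₀ _ k₀) (h _ _ _ h₀ _ k₁))
        (ha _ _ (h _ _ _ h₁ _ k₀) (h _ _ _ h₁ _ k₁))
  exact key x

theorem tensor_mul_hom {i j : ZMod 2} (a : E₁.carrier) {b : E₂.carrier} (hb : b ∈ E₂.grading i)
    {a' : E₁.carrier} (ha' : a' ∈ E₁.grading j) (b' : E₂.carrier) :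
    (tensorInl E₁ E₂ a * tensorInr E₁ E₂ b) * (tensorInl E₁ E₂ a' * tensorInr E₁ E₂ b') =
      (-1 : ℤˣ) ^ (i * j) • (tensorInl E₁ E₂ (a * a') * tensorInr E₁ E₂ (b * b')) := by
  simp only [tensorInl_mul_tensorInr]
  exact GradedTensorProduct.tmul_coe_mul_coe_tmul E₁.grading E₂.grading a ⟨b, hb⟩ ⟨a', ha'⟩ b'

variable (E₁ E₂) in
/-- The parity involution of the tensor product. -/
def tensorPar : Tensor E₁ E₂ →ₐ[k] Tensor E₁ E₂ :=
  GradedTensorProduct.lift _ _ ((tensorInl E₁ E₂).comp E₁.parHom)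
    ((tensorInr E₁ E₂).comp E₂.parHom) (by
      intro i j a b
      have h : tensorInr E₁ E₂ b * tensorInl E₁ E₂ a =
          (-1 : ℤˣ) ^ (j * i) • (tensorInl E₁ E₂ a * tensorInr E₁ E₂ b) := by
        have := tensor_mul_hom (E₁ := E₁) (E₂ := E₂) 1 b.2 a.2 1
        simpa only [map_one, one_mul, mul_one] using this
      have ha : E₁.parHom a = sgn k i • (a : E₁.carrier) := par_of_mem E₁.grading a.2
      have hb : E₂.parHom b = sgn k j • (b : E₂.carrier) := par_of_mem E₂.grading b.2
      simp only [AlgHom.comp_apply, ha, hb, map_smul, smul_mul_smul_comm]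
      rw [h, Units.smul_def, Units.smul_def, mul_comm, smul_comm (sgn k j * sgn k i),
        smul_smul, ← Units.val_mul, Int.units_mul_self, Units.val_one, one_smul])

theorem tensorPar_hom {i j : ZMod 2} {a : E₁.carrier} (ha : a ∈ E₁.grading i) {b : E₂.carrier}
    (hb : b ∈ E₂.grading j) : tensorPar E₁ E₂ (tensorInl E₁ E₂ a * tensorInr E₁ E₂ b) =
      sgn k (i + j) • (tensorInl E₁ E₂ a * tensorInr E₁ E₂ b) := by
  have ha : E₁.parHom a = sgn k i • (a : E₁.carrier) := par_of_mem E₁.grading ha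
  have hb : E₂.parHom b = sgn k j • (b : E₂.carrier) := par_of_mem E₂.grading hb
  have : tensorPar E₁ E₂ (tensorInl E₁ E₂ a * tensorInr E₁ E₂ b) =
      tensorInl E₁ E₂ (E₁.parHom a) * tensorInr E₁ E₂ (E₂.parHom b) := by
    rw [tensorInl_mul_tensorInr]
    exact GradedTensorProduct.lift_tmul _ _ _ _ _ _ _
  rw [this, ha, hb, map_smul, map_smul, smul_mul_smul_comm, sgn_add]

theorem tensorPar_inl (a : E₁.carrier) :
    tensorPar E₁ E₂ (tensorInl E₁ E₂ a) = tensorInl E₁ E₂ (E₁.par a) := by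
  refine (GradedTensorProduct.lift_tmul _ _ _ _ _ _ _).trans ?_
  rw [map_one, mul_one]
  rfl

theorem tensorPar_inr (b : E₂.carrier) :
    tensorPar E₁ E₂ (tensorInr E₁ E₂ b) = tensorInr E₁ E₂ (E₂.par b) := by
  refine (GradedTensorProduct.lift_tmul _ _ _ _ _ _ _).trans ?_
  rw [map_one, one_mul]
  rfl

theorem tensorPar_tensorPar (x : Tensor E₁ E₂) : tensorPar E₁ E₂ (tensorPar E₁ E₂ x) = x := by
  induction x using tensor_induction with
  | h0 => simp
  | ha x y hx hy => rw [map_add, map_add, hx, hy]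
  | h i j a ha b hb =>
    rw [tensorPar_hom ha hb, map_smul, tensorPar_hom ha hb, smul_smul, sgn_mul_self, one_smul]

/-- Supercommutativity in the form that `exists_quotient` requires; both sides are biadditive, so it
is a sign check over the sixteen parities of two homogeneous tensors. -/
theorem two_smul_tensor_mul (x y : Tensor E₁ E₂) :
    (2 : k) • (x * y) =
      y * (x + tensorPar E₁ E₂ x) + tensorPar E₁ E₂ y * (x - tensorPar E₁ E₂ x) := by
  induction x using tensor_induction with
  | h0 => simp
  | ha x x' hx hx' =>
    rw [add_mul, smul_add, hx, hx', map_add]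
    noncomm_ring
  | h i j a ha b hb =>
    induction y using tensor_induction with
    | h0 => simp
    | ha y y' hy hy' =>
      rw [mul_add, smul_add, hy, hy', map_add]
      noncomm_ring
    | h l m c hc d hd =>
      rw [tensorPar_hom ha hb, tensorPar_hom hc hd]
      simp only [mul_add, mul_sub, smul_mul_assoc, mul_smul_comm, tensor_mul_hom a hb hc d,
        tensor_mul_hom c hd ha b, E₁.mul_comm_of_homogeneous ha hc,
        E₂.mul_comm_of_homogeneous hb hd]
      rcases zmod_two_cases i with rfl | rfl <;> rcases zmod_two_cases j with rfl | rfl <;>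
      rcases zmod_two_cases l with rfl | rfl <;> rcases zmod_two_cases m with rfl | rfl <;>
      simp only [sgn_add, sgn_zero, sgn_one, two_smul, uzpow_one, uzpow_zero, Units.neg_smul,
        one_smul, neg_smul, mul_one, mul_zero, map_neg, neg_mul, mul_neg] <;> abel

end Tensor

/-- A push-out of two morphisms of superalgebras, with the properties of the quotient of the tensor
product by which it is constructed. -/
structure Pushout {B E₁ E₂ : SAlgf k} (β₁ : B ⟶ E₁) (β₂ : B ⟶ E₂) where
  P : SAlgf k
  inl : E₁ ⟶ P
  inr : E₂ ⟶ P
  w : β₁ ≫ inl = β₂ ≫ inr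
  exists_desc : ∀ (R : SAlgf k) (s : E₁ ⟶ R) (t : E₂ ⟶ R), β₁ ≫ s = β₂ ≫ t →
    ∃ m : P ⟶ R, inl ≫ m = s ∧ inr ≫ m = t
  induction : ∀ (N : Submodule k P.carrier),
    (∀ a b, Hom.toAlgHom inl a * Hom.toAlgHom inr b ∈ N) → ∀ x, x ∈ N
  exists_functional : ∀ F : E₁.carrier ⊗[k] E₂.carrier →ₗ[k] k,
    (∀ a b c, F ((a * Hom.toAlgHom β₁ b) ⊗ₜ c) = F (a ⊗ₜ (Hom.toAlgHom β₂ b * c))) →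
    ∃ G : P.carrier →ₗ[k] k, ∀ a c,
      G (Hom.toAlgHom inl a * Hom.toAlgHom inr c) = F (a ⊗ₜ c)

theorem Pushout.hom_ext {B E₁ E₂ : SAlgf k} {β₁ : B ⟶ E₁} {β₂ : B ⟶ E₂} (D : Pushout β₁ β₂)
    {R : SAlgf k} {f g : D.P ⟶ R} (hl : D.inl ≫ f = D.inl ≫ g) (hr : D.inr ≫ f = D.inr ≫ g) :
    f = g := by
  refine hom_ext' fun x => D.induction
    (LinearMap.eqLocus (Hom.toAlgHom f).toLinearMap (Hom.toAlgHom g).toLinearMap)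
    (fun a b => ?_) x
  simp only [LinearMap.mem_eqLocus, AlgHom.toLinearMap_apply, map_mul,
    ← comp_toAlgHom_apply, hl, hr]

/-- The push-out is the graded tensor product modulo the left ideal generated by the elements `g b =
β₁ b ⊗ 1 - 1 ⊗ β₂ b`. The functional property expresses that, as a vector space, it is the tensor
product balanced over `B`. -/
theorem nonempty_pushout [NeZero (2 : k)] {B E₁ E₂ : SAlgf k} (β₁ : B ⟶ E₁) (β₂ : B ⟶ E₂) :
    Nonempty (Pushout β₁ β₂) := by
  have h2 : (2 : k) ≠ 0 := two_ne_zero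
  let T := Tensor E₁ E₂
  let σ := tensorPar E₁ E₂
  let g : B.carrier →ₗ[k] T :=
    (tensorInl E₁ E₂).toLinearMap ∘ₗ (Hom.toAlgHom β₁).toLinearMap -
      (tensorInr E₁ E₂).toLinearMap ∘ₗ (Hom.toAlgHom β₂).toLinearMap
  have hg : ∀ b, g b = tensorInl E₁ E₂ (Hom.toAlgHom β₁ b) -
    tensorInr E₁ E₂ (Hom.toAlgHom β₂ b) := fun b => rfl
  have hσg : ∀ b, σ (g b) = g (B.par b) := by
    intro b
    rw [hg, hg, map_sub, tensorPar_inl, tensorPar_inr, par_hom, par_hom]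
  let I : Ideal T := Ideal.span (Set.range g)
  have hgI : ∀ b, g b ∈ I := fun b => Ideal.subset_span ⟨b, rfl⟩
  have hgm : ∀ b y, g b * y ∈ I := by
    intro b y
    -- `σ` permutes the generators, so the sign identity rewrites `2 (g b * y)` as an element of the
    -- left ideal; hence the ideal is two-sided.
    have h := two_smul_tensor_mul (g b) y
    have h' : (2 : k) • (g b * y) ∈ I := by
      rw [h]
      change _ * (_ + σ _) + _ * (_ - σ _) ∈ I
      rw [hσg]
      exact add_mem (I.mul_mem_left _ (add_mem (hgI _) (hgI _)))
        (I.mul_mem_left _ (sub_mem (hgI _) (hgI _)))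
    have := Submodule.smul_of_tower_mem I (2 : k)⁻¹ h'
    rwa [smul_smul, inv_mul_cancel₀ h2, one_smul] at this
  have : I.IsTwoSided := ⟨fun {x} y hx => by
    induction hx using Submodule.span_induction with
    | mem x hx =>
      obtain ⟨b, rfl⟩ := hx
      exact hgm b y
    | zero => simp
    | add a b _ _ ha hb => rw [add_mul]; exact add_mem ha hb
    | smul r a _ ha =>
      rw [smul_eq_mul, mul_assoc]
      exact I.mul_mem_left _ ha⟩
  have hσI : ∀ x ∈ I, σ x ∈ I := by
    intro x hx
    induction hx using Submodule.span_induction with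
    | mem x hx =>
      obtain ⟨b, rfl⟩ := hx
      rw [hσg]
      exact hgI _
    | zero => simp
    | add a b _ _ ha hb => rw [map_add]; exact add_mem ha hb
    | smul r a _ ha =>
      rw [smul_eq_mul, map_mul]
      exact I.mul_mem_left _ ha
  have : Module.Finite k T :=
    Module.Finite.equiv (GradedTensorProduct.of k E₁.grading E₂.grading)
  have : Module.Finite k (T ⧸ I) :=
    Module.Finite.of_surjective (Ideal.Quotient.mkₐ k I).toLinearMap
      (Ideal.Quotient.mkₐ_surjective k I)
  obtain ⟨P, q, hq, hqI, hqσ⟩ := exists_quotient σ tensorPar_tensorPar two_smul_tensor_mul I hσI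
  let inl : E₁ ⟶ P := homMk (q.comp (tensorInl E₁ E₂)) fun x => by
    rw [AlgHom.comp_apply, AlgHom.comp_apply, hqσ, tensorPar_inl]
  let inr : E₂ ⟶ P := homMk (q.comp (tensorInr E₁ E₂)) fun x => by
    rw [AlgHom.comp_apply, AlgHom.comp_apply, hqσ, tensorPar_inr]
  have hinl : ∀ a, Hom.toAlgHom inl a = q (tensorInl E₁ E₂ a) := fun _ => rfl
  have hinr : ∀ a, Hom.toAlgHom inr a = q (tensorInr E₁ E₂ a) := fun _ => rfl
  refine ⟨{ P := P, inl := inl, inr := inr, w := ?_, exists_desc := ?_, induction := ?_,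
            exists_functional := ?_ }⟩
  · refine hom_ext' fun b => ?_
    rw [comp_toAlgHom_apply, comp_toAlgHom_apply, hinl, hinr, ← sub_eq_zero, ← map_sub, hqI]
    exact hgI b
  · intro R s t hst
    let φ : T →ₐ[k] R.carrier := GradedTensorProduct.lift _ _ (Hom.toAlgHom s) (Hom.toAlgHom t)
      fun i j a b => R.mul_comm_of_homogeneous (s.isEven _ _ a.2) (t.isEven _ _ b.2)
    have hφ : ∀ a b, φ (tensorInl E₁ E₂ a * tensorInr E₁ E₂ b) =
        Hom.toAlgHom s a * Hom.toAlgHom t b := by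
      intro a b
      rw [tensorInl_mul_tensorInr]
      exact GradedTensorProduct.lift_tmul _ _ _ _ _ _ _
    have hφl : ∀ a, φ (tensorInl E₁ E₂ a) = Hom.toAlgHom s a := fun a => by
      simpa only [map_one, mul_one] using hφ a 1
    have hφr : ∀ a, φ (tensorInr E₁ E₂ a) = Hom.toAlgHom t a := fun a => by
      simpa only [map_one, one_mul] using hφ 1 a
    have hφI : ∀ x ∈ I, φ x = 0 := by
      intro x hx
      induction hx using Submodule.span_induction with
      | mem x hx =>
        obtain ⟨b, rfl⟩ := hx
        rw [hg, map_sub, hφl, hφr, ← comp_toAlgHom_apply, ← comp_toAlgHom_apply, hst, sub_self]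
      | zero => simp
      | add a b _ _ ha hb => rw [map_add, ha, hb, add_zero]
      | smul r a _ ha => rw [smul_eq_mul, map_mul, ha, mul_zero]
    obtain ⟨m, hm⟩ := exists_lift q hq φ fun x hx => hφI x ((hqI x).1 hx)
    have hφσ : ∀ x, R.par (φ x) = φ (σ x) := by
      intro x
      induction x using tensor_induction with
      | h0 => simp
      | ha x y hx hy => simp only [map_add, hx, hy]
      | h i j a ha b hb =>
        rw [map_mul σ, tensorPar_inl, tensorPar_inr, hφ, hφ, par_mul, par_hom, par_hom]
    refine ⟨homMk m fun x => ?_, hom_ext' fun a => (hm _).trans (hφl a),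
      hom_ext' fun a => (hm _).trans (hφr a)⟩
    obtain ⟨x, rfl⟩ := hq x
    rw [hqσ, hm, hm, hφσ]
  · intro N hN x
    obtain ⟨x, rfl⟩ := hq x
    induction x using tensor_induction with
    | h0 => simp
    | ha x y hx hy => rw [map_add]; exact add_mem hx hy
    | h i j a ha b hb => rw [map_mul]; exact hN a b
  · intro F hF
    let F' : T →ₗ[k] k := F ∘ₗ (GradedTensorProduct.of k E₁.grading E₂.grading).symm.toLinearMap
    have hF' : ∀ a b, F' (tensorInl E₁ E₂ a * tensorInr E₁ E₂ b) = F (a ⊗ₜ b) := by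
      intro a b
      rw [tensorInl_mul_tensorInr]
      rfl
    -- With the generator between the two factors, the vanishing is exactly the balancing condition
    -- on `F`. The next step moves a generator from the right end into this position by the sign
    -- identity.
    have h1 : ∀ a b c, F' (tensorInl E₁ E₂ a * g b * tensorInr E₁ E₂ c) = 0 := by
      intro a b c
      rw [hg, mul_sub, sub_mul, ← map_mul, mul_assoc, ← map_mul, map_sub, hF', hF', hF, sub_self]
    have h2' : ∀ b r, F' (r * g b) = 0 := by
      intro b r
      induction r using tensor_induction with
      | h0 => simp
      | ha x y hx hy => rw [add_mul, map_add, hx, hy, add_zero]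
      | h i j a ha c hc =>
        have h := two_smul_tensor_mul (tensorInr E₁ E₂ c) (g b)
        have h' : (2 : k) • F' (tensorInl E₁ E₂ a * tensorInr E₁ E₂ c * g b) = 0 := by
          rw [← map_smul, mul_assoc, ← mul_smul_comm, h]
          change F' (_ * (_ + σ (g b) * _)) = 0
          rw [hσg, tensorPar_inr, ← map_add, ← map_sub, mul_add, map_add, ← mul_assoc,
            ← mul_assoc, h1, h1, add_zero]
        exact (smul_eq_zero_iff_right h2).1 h'
    have h3 : ∀ x ∈ I, ∀ r, F' (r * x) = 0 := by
      intro x hx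
      induction hx using Submodule.span_induction with
      | mem x hx =>
        obtain ⟨b, rfl⟩ := hx
        exact h2' b
      | zero => simp
      | add a b _ _ ha hb => intro r; rw [mul_add, map_add, ha, hb, add_zero]
      | smul c a _ ha => intro r; rw [smul_eq_mul, ← mul_assoc, ha]
    -- Since `F'` kills the ideal, any linear section of the quotient map induces the functional.
    obtain ⟨s, hs⟩ := LinearMap.exists_rightInverse_of_surjective q.toLinearMap
      (LinearMap.range_eq_top.2 hq)
    refine ⟨F' ∘ₗ s, fun a c => ?_⟩
    rw [hinl, hinr, ← map_mul, ← hF', LinearMap.comp_apply, ← sub_eq_zero, ← map_sub]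
    have hm : s (q (tensorInl E₁ E₂ a * tensorInr E₁ E₂ c)) -
        tensorInl E₁ E₂ a * tensorInr E₁ E₂ c ∈ I := by
      rw [← hqI, map_sub, sub_eq_zero]
      exact LinearMap.congr_fun hs _
    simpa using h3 _ hm 1

end SAlgf

end FormalSuper

namespace FormalSuper

/-! ### The fibre product and its points. -/

section KernelPair

variable {k : Type u} [Field k]

/-- The functor of pairs of points of `X` with the same image in `Y`. -/
def kernelPair {X Y : SFFunt k} (f : X ⟶ Y) : SFFunt k where
  obj R := {p : X.obj R × X.obj R // f.app R p.1 = f.app R p.2}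
  map φ := ↾fun p => ⟨(X.map φ p.1.1, X.map φ p.1.2), by
    have h := p.2
    simp only [NatTrans.naturality_apply, h]⟩
  map_id R := by
    refine ConcreteCategory.hom_ext _ _ fun p => ?_
    have h₁ := ConcreteCategory.congr_hom (X.map_id R) p.1.1
    have h₂ := ConcreteCategory.congr_hom (X.map_id R) p.1.2
    exact Subtype.ext (Prod.ext h₁ h₂)
  map_comp φ χ := by
    refine ConcreteCategory.hom_ext _ _ fun p => ?_
    have h₁ := ConcreteCategory.congr_hom (X.map_comp φ χ) p.1.1
    have h₂ := ConcreteCategory.congr_hom (X.map_comp φ χ) p.1.2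
    exact Subtype.ext (Prod.ext h₁ h₂)

theorem kernelPair_map {X Y : SFFunt k} (f : X ⟶ Y) {R S : SAlgf k} (φ : R ⟶ S)
    (p : (kernelPair f).obj R) :
    ((kernelPair f).map φ p).1 = (X.map φ p.1.1, X.map φ p.1.2) := rfl

/-- On the chart `j` of `X`, `f` lands in a chart `B j` of `Y` and is given by `β j`. A pair of
points `s`, `t` of the chart has equal image in `Y` iff `β j ≫ s = β j ≫ t`, so such pairs are
represented by the push-out of `β j` with itself. -/
theorem isFormalSuperscheme_kernelPair [NeZero (2 : k)] {X Y : SFFunt k} (f : X ⟶ Y)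
    (hX : IsFormalSuperscheme k X) (hY : IsFormalSuperscheme k Y) :
    IsFormalSuperscheme k (kernelPair f) := by
  obtain ⟨J, _, _, _, ⟨C⟩⟩ := hX.exists_charts
  -- No compatibility between the choices for different `j` is needed: the transition maps come from
  -- the representability `rep`, and their functoriality from the injectivity `hζ`.
  choose B η β hβ hη using fun j => hY.exists_chart (f.app _ (C.ξ j))
  let D j := (SAlgf.nonempty_pushout (β j) (β j)).some
  let ζ : ∀ j, (kernelPair f).obj (D j).P := fun j =>
    ⟨(X.map (D j).inl (C.ξ j), X.map (D j).inr (C.ξ j)), by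
      simp only [NatTrans.naturality_apply, ← hβ]
      rw [← comp_apply, ← comp_apply, ← Functor.map_comp, ← Functor.map_comp, (D j).w]⟩
  have hζ : ∀ j R (m m' : (D j).P ⟶ R),
      (kernelPair f).map m (ζ j) = (kernelPair f).map m' (ζ j) → m = m' := by
    intro j R m m' h
    have h := congrArg Subtype.val h
    rw [kernelPair_map, kernelPair_map, Prod.mk.injEq] at h
    simp only [ζ, ← comp_apply, ← Functor.map_comp] at h
    exact (D j).hom_ext (C.mono _ _ _ _ h.1) (C.mono _ _ _ _ h.2)
  have rep : ∀ j R (p : (kernelPair f).obj R) (s t : (C.A.obj j).unop ⟶ R),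
      X.map s (C.ξ j) = p.1.1 → X.map t (C.ξ j) = p.1.2 → ∃ m : (D j).P ⟶ R,
        (D j).inl ≫ m = s ∧ (D j).inr ≫ m = t ∧ (kernelPair f).map m (ζ j) = p := by
    intro j R p s t hs ht
    have hst : β j ≫ s = β j ≫ t := by
      apply hη
      have h := p.2
      rw [← hs, ← ht, NatTrans.naturality_apply, NatTrans.naturality_apply, ← hβ] at h
      rw [Functor.map_comp, Functor.map_comp, comp_apply, comp_apply, h]
    obtain ⟨m, h1, h2⟩ := (D j).exists_desc R s t hst
    refine ⟨m, h1, h2, Subtype.ext ?_⟩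
    rw [kernelPair_map]
    refine Prod.ext ?_ ?_
    · rw [← hs, ← h1, Functor.map_comp, comp_apply]
    · rw [← ht, ← h2, Functor.map_comp, comp_apply]
  have tr : ∀ j l (u : j ⟶ l), ∃ m : (D l).P ⟶ (D j).P,
      (D l).inl ≫ m = (C.A.map u).unop ≫ (D j).inl ∧
      (D l).inr ≫ m = (C.A.map u).unop ≫ (D j).inr ∧ (kernelPair f).map m (ζ l) = ζ j := by
    intro j l u
    refine rep l _ (ζ j) _ _ ?_ ?_ <;>
      rw [Functor.map_comp, comp_apply, C.compat]
  choose m hml hmr hm using tr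
  refine Charts.isFormalSuperscheme (J := J)
    { A :=
        { obj := fun j => Opposite.op (D j).P
          map := fun u => (m _ _ u).op
          map_id := fun j => congrArg Quiver.Hom.op
            (hζ _ _ _ _ ((hm _ _ _).trans
              (ConcreteCategory.congr_hom ((kernelPair f).map_id _) (ζ j)).symm))
          map_comp := fun u v => congrArg Quiver.Hom.op
            (hζ _ _ _ _ (by
              rw [hm]
              refine Eq.trans ?_
                (ConcreteCategory.congr_hom ((kernelPair f).map_comp (m _ _ v) (m _ _ u)) _).symm
              rw [comp_apply, hm, hm])) }
      ξ := ζ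
      surj := fun j l u x => (D j).induction
        (LinearMap.range (SAlgf.Hom.toAlgHom (m j l u)).toLinearMap) (fun a b => ?_) x
      compat := fun j l u => hm j l u
      mono := fun j R s t => hζ j R s t
      cover := fun R p => ?_ }
  · obtain ⟨a, rfl⟩ := C.surj j l u a
    obtain ⟨b, rfl⟩ := C.surj j l u b
    refine ⟨SAlgf.Hom.toAlgHom (D l).inl a * SAlgf.Hom.toAlgHom (D l).inr b, ?_⟩
    rw [AlgHom.toLinearMap_apply, map_mul, ← SAlgf.comp_toAlgHom_apply, hml,
      ← SAlgf.comp_toAlgHom_apply, hmr, SAlgf.comp_toAlgHom_apply, SAlgf.comp_toAlgHom_apply]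
  · obtain ⟨j, s, hs⟩ := C.cover R p.1.1
    obtain ⟨l, t, ht⟩ := C.cover R p.1.2
    obtain ⟨n, hjn, hln⟩ := exists_ge_ge j l
    obtain ⟨r, -, -, hr⟩ := rep n R p ((C.A.map (homOfLE hjn)).unop ≫ s)
      ((C.A.map (homOfLE hln)).unop ≫ t)
      (by rw [Functor.map_comp, comp_apply, C.compat, hs])
      (by rw [Functor.map_comp, comp_apply, C.compat, ht])
    exact ⟨n, r, hr⟩

theorem hasPullback_self [NeZero (2 : k)] {X Y : FormalSuperscheme k} (f : X ⟶ Y) :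
    HasPullback f f := by
  let P : FormalSuperscheme k :=
    ⟨kernelPair f.hom, isFormalSuperscheme_kernelPair f.hom X.property Y.property⟩
  let p₁ : P ⟶ X := ObjectProperty.homMk
    { app := fun R => ↾fun p => p.1.1
      naturality := fun _ _ _ => rfl }
  let p₂ : P ⟶ X := ObjectProperty.homMk
    { app := fun R => ↾fun p => p.1.2
      naturality := fun _ _ _ => rfl }
  have w : p₁ ≫ f = p₂ ≫ f := by
    ext R p
    exact p.2
  refine ⟨⟨⟨_, PullbackCone.IsLimit.mk w
    (fun s => ObjectProperty.homMk
      { app := fun R => ↾fun x => ⟨(s.fst.hom.app R x, s.snd.hom.app R x),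
          ConcreteCategory.congr_hom (NatTrans.congr_app (congrArg (·.hom) s.condition) R) x⟩
        naturality := fun R S φ => ?_ })
    (fun s => rfl) (fun s => rfl) (fun s m h₁ h₂ => ?_)⟩⟩⟩
  · ext x
    have h₁ := ConcreteCategory.congr_hom (s.fst.hom.naturality φ) x
    have h₂ := ConcreteCategory.congr_hom (s.snd.hom.naturality φ) x
    exact Subtype.ext (Prod.ext h₁ h₂)
  · ext R x
    refine Subtype.ext (Prod.ext ?_ ?_)
    · exact ConcreteCategory.congr_hom (NatTrans.congr_app (congrArg (·.hom) h₁) R) x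
    · exact ConcreteCategory.congr_hom (NatTrans.congr_app (congrArg (·.hom) h₂) R) x

/-- The points of a fibre product of formal superschemes are the pairs of points with the same
image. -/
theorem exists_point_of_isPullback {X Y P : FormalSuperscheme k} {f : X ⟶ Y} {π₁ π₂ : P ⟶ X}
    (h : IsPullback π₁ π₂ f f) {R : SAlgf k} (x y : X.obj.obj R)
    (hxy : f.hom.app R x = f.hom.app R y) :
    ∃ p : P.obj.obj R, π₁.hom.app R p = x ∧ π₂.hom.app R p = y := by
  let T : FormalSuperscheme k := ⟨_, isFormalSuperscheme_coyoneda R⟩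
  let a : X.obj.obj R → (T ⟶ X) := fun x => ObjectProperty.homMk (coyonedaEquiv.symm x)
  have ha : ∀ x, (a x).hom.app R (𝟙 R) = x := fun x => coyonedaEquiv.apply_symm_apply x
  have hw : a x ≫ f = a y ≫ f := by
    apply ObjectProperty.hom_ext
    apply coyonedaEquiv.injective
    change f.hom.app R ((a x).hom.app R (𝟙 R)) = f.hom.app R ((a y).hom.app R (𝟙 R))
    rw [ha, ha, hxy]
  refine ⟨(h.lift _ _ hw).hom.app R (𝟙 R), ?_, ?_⟩
  · exact (ConcreteCategory.congr_hom (NatTrans.congr_app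
      (congrArg (·.hom) (h.lift_fst _ _ hw)) R) (𝟙 R)).trans (ha x)
  · exact (ConcreteCategory.congr_hom (NatTrans.congr_app
      (congrArg (·.hom) (h.lift_snd _ _ hw)) R) (𝟙 R)).trans (ha y)

end KernelPair

end FormalSuper

namespace FormalSuper

/-! ### Contraction of tensors with linear forms. -/

section Contraction

variable {k : Type u} [Field k]
variable {R V W : Type*} [AddCommGroup R] [Module k R] [AddCommGroup V] [Module k V]
  [AddCommGroup W] [Module k W]

/-- The contraction of the second factor of a tensor product with a linear form. -/
def contract (f : V →ₗ[k] k) : R ⊗[k] V →ₗ[k] R :=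
  (TensorProduct.rid k R).toLinearMap ∘ₗ LinearMap.lTensor R f

@[simp]
theorem contract_tmul (f : V →ₗ[k] k) (r : R) (v : V) :
    contract f (r ⊗ₜ[k] v) = f v • r := by simp [contract]

theorem contract_add (f g : V →ₗ[k] k) (u : R ⊗[k] V) :
    contract (f + g) u = contract f u + contract g u := by
  simp [contract, LinearMap.lTensor_add]

theorem contract_smul (c : k) (f : V →ₗ[k] k) (u : R ⊗[k] V) :
    contract (c • f) u = c • contract f u := by
  simp [contract, LinearMap.lTensor_smul]

theorem contract_map {R' V' : Type*} [AddCommGroup R'] [Module k R'] [AddCommGroup V']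
    [Module k V'] (φ : R →ₗ[k] R') (ψ : V →ₗ[k] V') (f : V' →ₗ[k] k) (u : R ⊗[k] V) :
    contract f (TensorProduct.map φ ψ u) = φ (contract (f ∘ₗ ψ) u) := by
  induction u with
  | zero => simp
  | add x y hx hy => simp only [map_add, hx, hy]
  | tmul r v => simp

theorem contract_lTensor {V' : Type*} [AddCommGroup V']
    [Module k V'] (ψ : V →ₗ[k] V') (f : V' →ₗ[k] k) (u : R ⊗[k] V) :
    contract f (LinearMap.lTensor R ψ u) = contract (f ∘ₗ ψ) u :=
  contract_map LinearMap.id ψ f u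

theorem eq_of_contract_basis {ι : Type*} (b : Module.Basis ι k V) {u v : R ⊗[k] V}
    (h : ∀ i, contract (b.coord i) u = contract (b.coord i) v) : u = v := by
  classical
  apply (TensorProduct.equivFinsuppOfBasisRight (M := R) b).injective
  ext i
  have key : ∀ w : R ⊗[k] V,
      TensorProduct.equivFinsuppOfBasisRight b w i = contract (b.coord i) w := by
    intro w
    induction w with
    | zero => simp
    | add x y hx hy => simp only [map_add, Finsupp.add_apply, hx, hy]
    | tmul r v => simp
  rw [key, key, h]

theorem eq_of_contract {u v : R ⊗[k] V} (h : ∀ f : V →ₗ[k] k, contract f u = contract f v) :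
    u = v :=
  eq_of_contract_basis (Module.Basis.ofVectorSpace k V) fun _ => h _

/-- The linear form `v ⊗ w ↦ f v * g w`. -/
def formTensor (f : V →ₗ[k] k) (g : W →ₗ[k] k) : V ⊗[k] W →ₗ[k] k :=
  LinearMap.mul' k k ∘ₗ TensorProduct.map f g

@[simp]
theorem formTensor_tmul (f : V →ₗ[k] k) (g : W →ₗ[k] k) (v : V) (w : W) :
    formTensor f g (v ⊗ₜ w) = f v * g w := rfl

/-- The coordinate forms of a product basis are decomposable, so the forms `f ⊗ g` already separate
tensors. -/
theorem eq_of_contract_tensor {u v : R ⊗[k] (V ⊗[k] W)}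
    (h : ∀ (f : V →ₗ[k] k) (g : W →ₗ[k] k),
      contract (formTensor f g) u = contract (formTensor f g) v) : u = v := by
  refine eq_of_contract_basis
    ((Module.Basis.ofVectorSpace k V).tensorProduct (Module.Basis.ofVectorSpace k W)) fun ⟨i, j⟩ => ?_
  have : ((Module.Basis.ofVectorSpace k V).tensorProduct (Module.Basis.ofVectorSpace k W)).coord
      (i, j) = formTensor ((Module.Basis.ofVectorSpace k V).coord i)
        ((Module.Basis.ofVectorSpace k W).coord j) := by
    ext v w
    simp [mul_comm]
  rw [this, h]

/-- Every tensor is supported on a finite-dimensional subspace of the second factor. -/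
theorem exists_finite_support (u : R ⊗[k] V) :
    ∃ N : Submodule k V, Module.Finite k N ∧ ∃ u' : R ⊗[k] N, N.subtype.lTensor R u' = u := by
  induction u with
  | zero => exact ⟨⊥, inferInstance, 0, by simp⟩
  | tmul r v =>
    exact ⟨Submodule.span k {v}, inferInstance,
      r ⊗ₜ ⟨v, Submodule.mem_span_singleton_self v⟩, by simp⟩
  | add x y hx hy =>
    obtain ⟨N, _, x, rfl⟩ := hx
    obtain ⟨M, _, y, rfl⟩ := hy
    refine ⟨N ⊔ M, Submodule.finite_sup N M,
      (Submodule.inclusion (le_sup_left : N ≤ N ⊔ M)).lTensor R x +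
      (Submodule.inclusion (le_sup_right : M ≤ N ⊔ M)).lTensor R y, ?_⟩
    rw [map_add, ← LinearMap.comp_apply, ← LinearMap.comp_apply, ← LinearMap.lTensor_comp,
      ← LinearMap.lTensor_comp]
    rfl

/-- The contraction of a tensor with a linear form only depends on the restriction of the form to a
support. -/
theorem exists_finite_contract (u : R ⊗[k] V) :
    ∃ N : Submodule k V, Module.Finite k N ∧ ∀ f : V →ₗ[k] k, (∀ v ∈ N, f v = 0) →
      contract f u = 0 := by
  obtain ⟨N, hN, u, rfl⟩ := exists_finite_support u
  refine ⟨N, hN, fun f hf => ?_⟩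
  rw [contract_lTensor, show f ∘ₗ N.subtype = 0 from LinearMap.ext fun v => hf v v.2]
  simp [contract]

end Contraction

/-! ### The dual algebra and the points of `Sp*`. -/

section DualAlgebra

variable {k : Type u} [Field k]

/-- The dual algebra of a super-coalgebra. The product is opposite to the convolution product; it
agrees with the convolution product twisted by the sign rule. -/
abbrev DualAlg (A : SCoalg k) : Type u := (WithConv (A.carrier →ₗ[k] k))ᵐᵒᵖ

namespace DualAlg

variable {A B : SCoalg k}

/-- The linear form underlying an element of the dual algebra. -/
def val : DualAlg A ≃ₗ[k] (A.carrier →ₗ[k] k) where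
  toFun x := x.unop.ofConv
  invFun f := MulOpposite.op (WithConv.toConv f)
  map_add' _ _ := rfl
  map_smul' _ _ := rfl
  left_inv _ := rfl
  right_inv _ := rfl

theorem val_mul (x y : DualAlg A) :
    val (x * y) = formTensor (val y) (val x) ∘ₗ Coalgebra.comul := rfl

/-- The algebra homomorphism between dual algebras induced by a linear map which is compatible with
comultiplication and counit. -/
def mapOfLinear (g : A.carrier →ₗ[k] B.carrier)
    (h₁ : TensorProduct.map g g ∘ₗ Coalgebra.comul = Coalgebra.comul ∘ₗ g)
    (h₂ : Coalgebra.counit ∘ₗ g = Coalgebra.counit) : DualAlg B →ₐ[k] DualAlg A :=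
  AlgHom.ofLinearMap (val.symm.toLinearMap ∘ₗ LinearMap.lcomp k k g ∘ₗ val.toLinearMap)
    (val.injective h₂) (fun x y => val.injective (by
      change val (x * y) ∘ₗ g = formTensor (val y ∘ₗ g) (val x ∘ₗ g) ∘ₗ Coalgebra.comul
      have : formTensor (val y ∘ₗ g) (val x ∘ₗ g) =
          formTensor (val y) (val x) ∘ₗ TensorProduct.map g g := by
        ext
        simp
      rw [this, val_mul, LinearMap.comp_assoc, LinearMap.comp_assoc, h₁]))

/-- The algebra homomorphism between dual algebras induced by a morphism of super-coalgebras. -/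
def map (ψ : A ⟶ B) : DualAlg B →ₐ[k] DualAlg A :=
  mapOfLinear (SCoalg.lin ψ) (CoalgHom.map_comp_comul (SCoalg.Hom.toCoalgHom ψ))
    (CoalgHom.counit_comp (SCoalg.Hom.toCoalgHom ψ))

theorem val_map (ψ : A ⟶ B) (x : DualAlg B) : val (map ψ x) = val x ∘ₗ SCoalg.lin ψ := rfl

end DualAlg

end DualAlgebra

namespace SCoalg

variable {k : Type u} [Field k] (A : SCoalg k)

/-- The parity involution of a super-coalgebra. -/
abbrev par : A.carrier →ₗ[k] A.carrier := FormalSuper.par A.grading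

theorem map_par_comp_comul [NeZero (2 : k)] :
    TensorProduct.map A.par A.par ∘ₗ Coalgebra.comul = Coalgebra.comul ∘ₗ A.par :=
  LinearMap.ext ((isEven_tensor_iff _ _ _).1 A.comul_isEven)

theorem counit_comp_par : Coalgebra.counit ∘ₗ A.par = Coalgebra.counit := by
  ext a
  obtain ⟨a, ha, b, hb, rfl⟩ := exists_even_add_odd A.grading a
  have h : Coalgebra.counit b = (0 : k) := by
    simpa [unitGrading] using A.counit_isEven 1 b hb
  simp [par_of_mem A.grading ha, par_of_mem A.grading hb, h]

theorem par_lin [NeZero (2 : k)] {A B : SCoalg k} (ψ : A ⟶ B) (a : A.carrier) :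
    B.par (lin ψ a) = lin ψ (A.par a) :=
  (isEven_iff _ _).1 ψ.isEven a

end SCoalg

namespace DualAlg

variable {k : Type u} [Field k] [NeZero (2 : k)] {A B : SCoalg k}

variable (A) in
/-- The parity involution of the dual algebra. -/
def par : DualAlg A →ₐ[k] DualAlg A :=
  mapOfLinear A.par A.map_par_comp_comul A.counit_comp_par

theorem val_par (x : DualAlg A) : val (par A x) = val x ∘ₗ A.par := rfl

theorem par_par (x : DualAlg A) : par A (par A x) = x := by
  apply val.injective
  ext a
  simp [val_par, FormalSuper.par_par]

/-- Super-cocommutativity allows `comul` to be replaced by its twist, and `two_smul_twist_tmul`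
expresses the twist through parity involutions. -/
theorem two_smul_mul (x y : DualAlg A) :
    (2 : k) • (x * y) = y * (x + par A x) + par A y * (x - par A x) := by
  apply val.injective
  have h : ∀ t : A.carrier ⊗[k] A.carrier,
      (2 : k) • formTensor (val y) (val x) (twist A.grading A.grading t) =
      formTensor (val x + val x ∘ₗ A.par) (val y) t +
      formTensor (val x - val x ∘ₗ A.par) (val y ∘ₗ A.par) t := by
    intro t
    induction t with
    | zero => simp
    | add s t hs ht => simp only [map_add, smul_add, hs, ht]; ring
    | tmul a b =>
      rw [← map_smul, two_smul_twist_tmul]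
      simp
      ring
  ext a
  have := h (Coalgebra.comul a)
  rw [← LinearMap.comp_apply (twist _ _), A.super_cocomm] at this
  rw [map_smul, map_add, val_mul, val_mul, val_mul, map_add, map_sub, val_par, val_par]
  exact this

theorem map_par (ψ : A ⟶ B) (x : DualAlg B) : map ψ (par B x) = par A (map ψ x) := by
  apply val.injective
  ext a
  simp [val_par, val_map, SCoalg.par_lin]

end DualAlg

section GroupLike

variable {k : Type u} [Field k] [NeZero (2 : k)] {R : SAlgf k} {A : SCoalg k}

omit [NeZero (2 : k)] in
theorem two_smul_contract_tensorOver (f g : A.carrier →ₗ[k] k) (u : R.carrier ⊗[k] A.carrier)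
    (r : R.carrier) (a : A.carrier) :
    (2 : k) • contract (formTensor f g) (tensorOver R A (u ⊗ₜ (r ⊗ₜ a))) =
      g a • ((contract f u + contract (f ∘ₗ A.par) u) * r +
        (contract f u - contract (f ∘ₗ A.par) u) * R.par r) := by
  induction u with
  | zero => simp
  | add x y hx hy =>
    rw [TensorProduct.add_tmul, map_add, map_add, smul_add, hx, hy, ← smul_add, map_add, map_add]
    congr 1
    simp only [add_mul, sub_mul]
    abel
  | tmul s b =>
    have h : (2 : k) • tensorOver R A ((s ⊗ₜ b) ⊗ₜ (r ⊗ₜ a)) =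
        (s * r) ⊗ₜ ((b + A.par b) ⊗ₜ a) + (s * R.par r) ⊗ₜ ((b - A.par b) ⊗ₜ a) := by
      have := two_smul_twist_tmul A.grading R.grading b r
      have h : ∀ t : R.carrier ⊗[k] A.carrier,
          (LinearMap.mul' k R.carrier).rTensor (A.carrier ⊗[k] A.carrier)
            ((TensorProduct.assoc k R.carrier R.carrier (A.carrier ⊗[k] A.carrier)).symm
              (s ⊗ₜ (TensorProduct.assoc k R.carrier A.carrier A.carrier) (t ⊗ₜ a))) =
          TensorProduct.map (LinearMap.mulLeft k s) ((TensorProduct.mk k _ _).flip a) t := by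
        intro t
        induction t with
        | zero => simp
        | add x y hx hy => simp only [map_add, TensorProduct.add_tmul, TensorProduct.tmul_add,
            hx, hy]
        | tmul x y => simp
      have h' : tensorOver R A ((s ⊗ₜ b) ⊗ₜ (r ⊗ₜ a)) =
          TensorProduct.map (LinearMap.mulLeft k s) ((TensorProduct.mk k _ _).flip a)
            (twist A.grading R.grading (b ⊗ₜ r)) := by
        rw [← h]
        simp [tensorOver]
      rw [h', ← map_smul, this]
      simp [TensorProduct.add_tmul, TensorProduct.sub_tmul]
    rw [← map_smul, h]
    simp only [map_add, contract_tmul, formTensor_tmul, LinearMap.comp_apply, map_sub,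
      smul_mul_assoc, add_mul, sub_mul, mul_smul, add_smul, sub_smul, smul_add, smul_sub,
      smul_comm (g a)]

/-- For even `u`, parity on the form equals parity on the contraction. The sign in `⊗_R` is then the
one for exchanging the two factors in `R`, so the product appears in reversed order without a sign.
This is why the dual algebra carries the opposite product. -/
theorem contract_tensorOver {u : R.carrier ⊗[k] A.carrier}
    (hu : ∀ f : A.carrier →ₗ[k] k, R.par (contract f u) = contract (f ∘ₗ A.par) u)
    (f g : A.carrier →ₗ[k] k) (v : R.carrier ⊗[k] A.carrier) :
    contract (formTensor f g) (tensorOver R A (u ⊗ₜ v)) = contract g v * contract f u := by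
  have h2 : (2 : k) ≠ 0 := two_ne_zero
  induction v with
  | zero => simp
  | add x y hx hy => simp only [TensorProduct.tmul_add, map_add, hx, hy, add_mul]
  | tmul r a =>
    apply (smul_right_inj h2).1
    rw [two_smul_contract_tensorOver, ← hu, contract_tmul, smul_mul_assoc, smul_comm]
    congr 1
    have he : contract f u + R.par (contract f u) ∈ R.grading 0 := by
      rw [mem_iff_par, map_add, FormalSuper.par_par, sgn_zero, one_smul, add_comm]
    have ho : contract f u - R.par (contract f u) ∈ R.grading 1 := by
      rw [mem_iff_par, map_sub, FormalSuper.par_par, sgn_one, neg_smul, one_smul, neg_sub]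
    rw [R.even_central _ he, R.mul_eq_of_odd ho, FormalSuper.par_par, mul_add, mul_sub, two_smul]
    abel

/-- Evenness is invariance under `par ⊗ par`, and since `par` is an involution one factor can be
moved to the other side. -/
theorem even_iff_contract {u : R.carrier ⊗[k] A.carrier} :
    u ∈ tensorGrading R.grading A.grading 0 ↔
      ∀ f : A.carrier →ₗ[k] k, R.par (contract f u) = contract (f ∘ₗ A.par) u := by
  rw [mem_tensorGrading_iff, sgn_zero, one_smul]
  constructor
  · intro h f
    conv_lhs => rw [← h]
    rw [contract_map, FormalSuper.par_par]
  · intro h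
    refine eq_of_contract fun f => ?_
    rw [contract_map, h, LinearMap.comp_assoc]
    congr 1
    ext a
    simp [FormalSuper.par_par]

/-- Group-like elements in terms of contractions. -/
theorem isGroupLike_iff {u : R.carrier ⊗[k] A.carrier} :
    IsGroupLike R A u ↔
      (∀ x : DualAlg A, R.par (contract (DualAlg.val x) u) =
        contract (DualAlg.val (DualAlg.par A x)) u) ∧
      (∀ x y : DualAlg A, contract (DualAlg.val (x * y)) u =
        contract (DualAlg.val x) u * contract (DualAlg.val y) u) ∧
      contract (DualAlg.val (1 : DualAlg A)) u = 1 := by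
  constructor
  · intro h
    have he := even_iff_contract.1 h.even
    refine ⟨fun x => he _, fun x y => ?_, h.counit⟩
    rw [DualAlg.val_mul, ← contract_lTensor, h.comul, contract_tensorOver he]
  · rintro ⟨h₁, h₂, h₃⟩
    have he : ∀ f : A.carrier →ₗ[k] k, R.par (contract f u) = contract (f ∘ₗ A.par) u :=
      fun f => h₁ (DualAlg.val.symm f)
    refine ⟨even_iff_contract.2 he, eq_of_contract_tensor fun f g => ?_, h₃⟩
    rw [contract_lTensor, contract_tensorOver he]
    exact h₂ (DualAlg.val.symm g) (DualAlg.val.symm f)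

/-- The algebra homomorphism from the dual algebra defined by a group-like element. -/
def IsGroupLike.evalHom {u : R.carrier ⊗[k] A.carrier} (hu : IsGroupLike R A u) :
    DualAlg A →ₐ[k] R.carrier :=
  AlgHom.ofLinearMap
    { toFun := fun x => contract (DualAlg.val x) u
      map_add' := fun x y => by rw [map_add, contract_add]
      map_smul' := fun c x => by rw [map_smul, contract_smul]; rfl }
    (isGroupLike_iff.1 hu).2.2 (isGroupLike_iff.1 hu).2.1

/-- The algebra homomorphism from the dual algebra defined by a point of `Sp* A`. -/
def evalPt (u : ((SpStar k).obj A).obj R) : DualAlg A →ₐ[k] R.carrier := u.2.evalHom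

theorem par_evalPt (u : ((SpStar k).obj A).obj R) (x : DualAlg A) :
    R.par (evalPt u x) = evalPt u (DualAlg.par A x) :=
  (isGroupLike_iff.1 u.2).1 x

theorem evalPt_injective {u v : ((SpStar k).obj A).obj R} (h : ∀ x, evalPt u x = evalPt v x) :
    u = v :=
  Subtype.ext (eq_of_contract fun f => h (DualAlg.val.symm f))

theorem evalPt_map {S : SAlgf k} (φ : R ⟶ S) (u : ((SpStar k).obj A).obj R) (x : DualAlg A) :
    evalPt (((SpStar k).obj A).map φ u) x = SAlgf.Hom.toAlgHom φ (evalPt u x) :=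
  contract_map _ _ _ _

theorem evalPt_app {B : SCoalg k} (ψ : A ⟶ B) (u : ((SpStar k).obj A).obj R) (x : DualAlg B) :
    evalPt (((SpStar k).map ψ).app R u) x = evalPt u (DualAlg.map ψ x) :=
  contract_map _ _ _ _

/-- An even algebra homomorphism from the dual algebra which only depends on the restriction of
linear forms to a finite-dimensional subspace comes from a group-like element. -/
theorem exists_evalPt_eq (φ : DualAlg A →ₐ[k] R.carrier)
    (hφ : ∀ x, R.par (φ x) = φ (DualAlg.par A x)) (D : Submodule k A.carrier)
    [Module.Finite k D] (hD : ∀ x : DualAlg A, (∀ a ∈ D, DualAlg.val x a = 0) → φ x = 0) :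
    ∃ u : ((SpStar k).obj A).obj R, ∀ x, evalPt u x = φ x := by
  obtain ⟨p, hp⟩ := LinearMap.exists_leftInverse_of_injective D.subtype D.ker_subtype
  let b := Module.finBasis k D
  -- The image under `φ` of the canonical element of the dual bases of `D`, with the coordinate
  -- forms extended to `A` along the retraction `p`; by `hD`, `φ` does not depend on the extension.
  let u : R.carrier ⊗[k] A.carrier :=
    ∑ i, φ (DualAlg.val.symm (b.coord i ∘ₗ p)) ⊗ₜ (b i : A.carrier)
  have hu : ∀ x, contract (DualAlg.val x) u = φ x := by
    intro x
    have h0 : φ x = φ (DualAlg.val.symm (DualAlg.val x ∘ₗ D.subtype ∘ₗ p)) := by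
      rw [← sub_eq_zero, ← map_sub]
      refine hD _ fun a ha => ?_
      have : p a = ⟨a, ha⟩ := LinearMap.congr_fun hp ⟨a, ha⟩
      simp [this]
    have h1 : DualAlg.val x ∘ₗ D.subtype ∘ₗ p =
        ∑ i, DualAlg.val x (b i) • (b.coord i ∘ₗ p) := by
      ext a
      have := congrArg (fun d : D => DualAlg.val x d) (b.sum_repr (p a))
      simp only [Submodule.coe_sum, map_sum, Submodule.coe_smul, map_smul] at this
      simp only [LinearMap.comp_apply, LinearMap.sum_apply, LinearMap.smul_apply,
        Module.Basis.coord_apply, Submodule.subtype_apply, ← this]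
      exact Finset.sum_congr rfl fun i _ => by simp [mul_comm]
    rw [h0, h1]
    simp only [u, map_sum, map_smul, contract_tmul]
  exact ⟨⟨u, isGroupLike_iff.2 ⟨fun x => by rw [hu, hu, hφ], fun x y => by
    rw [hu, hu, hu, map_mul], by rw [hu, map_one]⟩⟩, hu⟩

end GroupLike

end FormalSuper

namespace FormalSuper

/-! ### Finite-dimensional super-subcoalgebras and their dual superalgebras. -/

section Orbit

variable {k : Type u} [Field k] {V : Type u} [AddCommGroup V] [Module k V]

/-- The subspace generated by the images of a subspace under a family of endomorphisms. -/
def orbitSpan {ι : Type*} (T : ι → V →ₗ[k] V) (N : Submodule k V) : Submodule k V :=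
  ⨆ i, N.map (T i)

theorem mem_orbitSpan {ι : Type*} (T : ι → V →ₗ[k] V) {N : Submodule k V} (i : ι) {v : V}
    (hv : v ∈ N) : T i v ∈ orbitSpan T N :=
  Submodule.mem_iSup_of_mem i (Submodule.mem_map_of_mem hv)

theorem map_mem_orbitSpan {ι : Type*} {T : ι → V →ₗ[k] V} {N : Submodule k V} {S : V →ₗ[k] V}
    (h : ∀ i, ∀ v ∈ N, S (T i v) ∈ orbitSpan T N) {v : V} (hv : v ∈ orbitSpan T N) :
    S v ∈ orbitSpan T N := by
  have : orbitSpan T N ≤ (orbitSpan T N).comap S :=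
    iSup_le fun i => Submodule.map_le_iff_le_comap.2 fun v hv => h i v hv
  exact this hv

theorem finite_orbitSpan {ι : Type*} {T : ι → V →ₗ[k] V}
    (hT : ∀ v, ∃ M : Submodule k V, Module.Finite k M ∧ ∀ i, T i v ∈ M) (N : Submodule k V)
    [Module.Finite k N] : Module.Finite k (orbitSpan T N) := by
  suffices h : ∃ M : Submodule k V, Module.Finite k M ∧ orbitSpan T N ≤ M by
    obtain ⟨M, _, hM⟩ := h
    exact Submodule.finiteDimensional_of_le hM
  refine Submodule.fg_induction
    (motive := fun N _ => ∃ M : Submodule k V, Module.Finite k M ∧ orbitSpan T N ≤ M)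
    (fun v => ?_) ?_ N (Module.Finite.iff_fg.1 inferInstance)
  · obtain ⟨M, hM, h⟩ := hT v
    refine ⟨M, hM, iSup_le fun i => ?_⟩
    rw [Submodule.map_span_le]
    simpa using h i
  · rintro N₁ N₂ - - ⟨M₁, _, h₁⟩ ⟨M₂, _, h₂⟩
    refine ⟨M₁ ⊔ M₂, Submodule.finite_sup _ _, iSup_le fun i => ?_⟩
    rw [Submodule.map_sup]
    exact sup_le_sup ((le_iSup (fun i => N₁.map (T i)) i).trans h₁)
      ((le_iSup (fun i => N₂.map (T i)) i).trans h₂)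

/-- A tensor has finitely many terms, whose left factors span all its contractions. Applied to
`comul a` and its flip, this is the local finiteness behind the fundamental theorem of coalgebras.
-/
theorem exists_finite_contract_mem {W : Type*} [AddCommGroup W] [Module k W] (t : V ⊗[k] W) :
    ∃ M : Submodule k V, Module.Finite k M ∧ ∀ f : W →ₗ[k] k, contract f t ∈ M := by
  induction t with
  | zero => exact ⟨⊥, inferInstance, by simp⟩
  | tmul v w =>
    exact ⟨Submodule.span k {v}, inferInstance, fun f => by
      rw [contract_tmul]
      exact Submodule.smul_mem _ _ (Submodule.mem_span_singleton_self v)⟩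
  | add x y hx hy =>
    obtain ⟨M₁, _, h₁⟩ := hx
    obtain ⟨M₂, _, h₂⟩ := hy
    refine ⟨M₁ ⊔ M₂, Submodule.finite_sup _ _, fun f => ?_⟩
    rw [map_add]
    exact Submodule.add_mem_sup (h₁ f) (h₂ f)

end Orbit

namespace DualAlg

variable {k : Type u} [Field k] {A B : SCoalg k}

/-- Identities in `A` can thus be checked against forms, which turns coassociativity into
associativity of the dual algebra. -/
theorem ext_val {a b : A.carrier} (h : ∀ x : DualAlg A, val x a = val x b) : a = b := by
  rw [← sub_eq_zero, ← Module.forall_dual_apply_eq_zero_iff k]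
  intro f
  have := h (val.symm f)
  simp only [LinearEquiv.apply_symm_apply] at this
  rw [map_sub, this, sub_self]

/-- The transpose of right multiplication by `x`. -/
def leftAct (x : DualAlg A) : A.carrier →ₗ[k] A.carrier :=
  contract (val x) ∘ₗ (TensorProduct.comm k A.carrier A.carrier).toLinearMap ∘ₗ Coalgebra.comul

/-- The transpose of left multiplication by `x`. -/
def rightAct (x : DualAlg A) : A.carrier →ₗ[k] A.carrier :=
  contract (val x) ∘ₗ Coalgebra.comul

theorem val_leftAct (x y : DualAlg A) (a : A.carrier) :
    val y (leftAct x a) = val (y * x) a := by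
  rw [val_mul, leftAct, LinearMap.comp_apply, LinearMap.comp_apply, LinearMap.comp_apply]
  generalize (Coalgebra.comul a : A.carrier ⊗[k] A.carrier) = t
  induction t with
  | zero => simp
  | add s t hs ht => simp only [map_add, hs, ht]
  | tmul a b => simp

theorem val_rightAct (x y : DualAlg A) (a : A.carrier) :
    val y (rightAct x a) = val (x * y) a := by
  rw [val_mul, rightAct, LinearMap.comp_apply, LinearMap.comp_apply]
  generalize (Coalgebra.comul a : A.carrier ⊗[k] A.carrier) = t
  induction t with
  | zero => simp
  | add s t hs ht => simp only [map_add, hs, ht]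
  | tmul a b => simp [mul_comm]

theorem finite_orbitSpan_leftAct (N : Submodule k A.carrier) [Module.Finite k N] :
    Module.Finite k (orbitSpan (leftAct (A := A)) N) :=
  finite_orbitSpan (fun a => by
    obtain ⟨M, hM, h⟩ := exists_finite_contract_mem
      (TensorProduct.comm k A.carrier A.carrier (Coalgebra.comul a))
    exact ⟨M, hM, fun x => h (val x)⟩) N

theorem finite_orbitSpan_rightAct (N : Submodule k A.carrier) [Module.Finite k N] :
    Module.Finite k (orbitSpan (rightAct (A := A)) N) :=
  finite_orbitSpan (fun a => by
    obtain ⟨M, hM, h⟩ := exists_finite_contract_mem (Coalgebra.comul a : A.carrier ⊗[k] A.carrier)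
    exact ⟨M, hM, fun x => h (val x)⟩) N

end DualAlg

open DualAlg

namespace DualAlg

variable {k : Type u} [Field k] {A B : SCoalg k}

theorem val_par_apply [NeZero (2 : k)] (x : DualAlg A) (a : A.carrier) :
    val (par A x) a = val x (A.par a) := rfl

theorem val_map_apply (ψ : A ⟶ B) (x : DualAlg B) (a : A.carrier) :
    val (map ψ x) a = val x (SCoalg.lin ψ a) := rfl

end DualAlg

/-- A finite-dimensional super-subcoalgebra, described as a subspace stable under the parity
involution and under both actions of the dual algebra. -/
structure FinSub {k : Type u} [Field k] (A : SCoalg k) where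
  carrier : Submodule k A.carrier
  [finite : Module.Finite k carrier]
  left_mem : ∀ (x : DualAlg A), ∀ a ∈ carrier, leftAct x a ∈ carrier
  right_mem : ∀ (x : DualAlg A), ∀ a ∈ carrier, rightAct x a ∈ carrier
  par_mem : ∀ a ∈ carrier, A.par a ∈ carrier

namespace FinSub

attribute [instance] finite

variable {k : Type u} [Field k] [NeZero (2 : k)] {A B : SCoalg k}

/-- The fundamental theorem of coalgebras: finite-dimensional subspaces lie in finite-dimensional
super-subcoalgebras. -/
theorem exists_le (N : Submodule k A.carrier) [Module.Finite k N] :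
    ∃ D : FinSub A, N ≤ D.carrier := by
  -- The subspace is saturated under parity, then the left action, then the right action. The two
  -- actions commute and parity intertwines each with itself, so every saturation preserves the
  -- earlier stability.
  let N₁ := N ⊔ N.map A.par
  have : Module.Finite k N₁ := Submodule.finite_sup _ _
  have h₁ : ∀ a ∈ N₁, A.par a ∈ N₁ := by
    intro a ha
    obtain ⟨b, hb, _, ⟨c, hc, rfl⟩, rfl⟩ := Submodule.mem_sup.1 ha
    rw [map_add, FormalSuper.par_par, add_comm]
    exact Submodule.add_mem_sup hc (Submodule.mem_map_of_mem hb)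
  let N₂ := orbitSpan (leftAct (A := A)) N₁
  have : Module.Finite k N₂ := finite_orbitSpan_leftAct N₁
  have h₁₂ : N₁ ≤ N₂ := fun a ha => by
    have : leftAct 1 a = a := ext_val fun x => by rw [val_leftAct, mul_one]
    exact this ▸ mem_orbitSpan _ 1 ha
  have hl₂ : ∀ x, ∀ a ∈ N₂, leftAct x a ∈ N₂ := fun x a ha =>
    map_mem_orbitSpan (fun y a ha => by
      have : leftAct x (leftAct y a) = leftAct (x * y) a :=
        ext_val fun z => by simp only [val_leftAct, mul_assoc]
      rw [this]
      exact mem_orbitSpan _ _ ha) ha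
  have hp₂ : ∀ a ∈ N₂, A.par a ∈ N₂ := fun a ha =>
    map_mem_orbitSpan (fun y a ha => by
      have : A.par (leftAct y a) = leftAct (DualAlg.par A y) (A.par a) := ext_val fun z => by
        rw [← val_par_apply, val_leftAct, val_leftAct, ← val_par_apply, map_mul (DualAlg.par A),
          DualAlg.par_par]
      rw [this]
      exact mem_orbitSpan _ _ (h₁ a ha)) ha
  let N₃ := orbitSpan (rightAct (A := A)) N₂
  have : Module.Finite k N₃ := finite_orbitSpan_rightAct N₂
  have h₂₃ : N₂ ≤ N₃ := fun a ha => by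
    have : rightAct 1 a = a := ext_val fun x => by rw [val_rightAct, one_mul]
    exact this ▸ mem_orbitSpan _ 1 ha
  refine ⟨⟨N₃, fun x a ha => ?_, fun x a ha => ?_, fun a ha => ?_⟩,
    le_sup_left.trans (h₁₂.trans h₂₃)⟩
  · refine map_mem_orbitSpan (fun y a ha => ?_) ha
    have : leftAct x (rightAct y a) = rightAct y (leftAct x a) :=
      ext_val fun z => by simp only [val_leftAct, val_rightAct, mul_assoc]
    rw [this]
    exact mem_orbitSpan _ _ (hl₂ x a ha)
  · refine map_mem_orbitSpan (fun y a ha => ?_) ha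
    have : rightAct x (rightAct y a) = rightAct (y * x) a :=
      ext_val fun z => by simp only [val_rightAct, mul_assoc]
    rw [this]
    exact mem_orbitSpan _ _ ha
  · refine map_mem_orbitSpan (fun y a ha => ?_) ha
    have : A.par (rightAct y a) = rightAct (DualAlg.par A y) (A.par a) := ext_val fun z => by
      rw [← val_par_apply, val_rightAct, val_rightAct, ← val_par_apply, map_mul (DualAlg.par A),
        DualAlg.par_par]
    rw [this]
    exact mem_orbitSpan _ _ (hp₂ a ha)

/-- The image of a finite-dimensional super-subcoalgebra. -/
def map (ψ : A ⟶ B) (D : FinSub A) : FinSub B where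
  carrier := D.carrier.map (SCoalg.lin ψ)
  left_mem := by
    rintro x _ ⟨a, ha, rfl⟩
    refine ⟨leftAct (DualAlg.map ψ x) a, D.left_mem _ a ha, ext_val fun y => ?_⟩
    rw [val_leftAct, ← val_map_apply, ← val_map_apply, val_leftAct, map_mul (DualAlg.map ψ)]
  right_mem := by
    rintro x _ ⟨a, ha, rfl⟩
    refine ⟨rightAct (DualAlg.map ψ x) a, D.right_mem _ a ha, ext_val fun y => ?_⟩
    rw [val_rightAct, ← val_map_apply, ← val_map_apply, val_rightAct, map_mul (DualAlg.map ψ)]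
  par_mem := by
    rintro _ ⟨a, ha, rfl⟩
    exact ⟨_, D.par_mem a ha, (SCoalg.par_lin ψ a).symm⟩

/-- The annihilator of `D` is a parity-stable ideal, two-sided because the actions are the
transposes of the multiplications. It has finite codimension because the forms on `D`, extended
along a retraction, represent all classes. -/
theorem exists_dual (D : FinSub A) :
    ∃ (E : SAlgf k) (q : DualAlg A →ₐ[k] E.carrier), Function.Surjective q ∧
      (∀ x, q x = 0 ↔ ∀ a ∈ D.carrier, val x a = 0) ∧ ∀ x, E.par (q x) = q (DualAlg.par A x) := by
  let I : Ideal (DualAlg A) :=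
    { carrier := {x | ∀ a ∈ D.carrier, val x a = 0}
      add_mem' := fun {x y} hx hy a ha => by
        rw [map_add, LinearMap.add_apply, hx a ha, hy a ha, add_zero]
      zero_mem' := fun a _ => rfl
      smul_mem' := fun y x hx a ha => by
        rw [smul_eq_mul, ← val_rightAct]
        exact hx _ (D.right_mem _ a ha) }
  have : I.IsTwoSided := ⟨fun {x} y hx a ha => by
    rw [← val_leftAct]
    exact hx _ (D.left_mem _ a ha)⟩
  obtain ⟨p, hp⟩ := LinearMap.exists_leftInverse_of_injective D.carrier.subtype
    D.carrier.ker_subtype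
  have : Module.Finite k (DualAlg A ⧸ I) := by
    refine Module.Finite.of_surjective ((Ideal.Quotient.mkₐ k I).toLinearMap ∘ₗ
      val.symm.toLinearMap ∘ₗ LinearMap.lcomp k k p) fun x => ?_
    obtain ⟨x, rfl⟩ := Ideal.Quotient.mkₐ_surjective k I x
    refine ⟨val x ∘ₗ D.carrier.subtype, Ideal.Quotient.eq.2 fun a ha => ?_⟩
    have : p a = ⟨a, ha⟩ := LinearMap.congr_fun hp ⟨a, ha⟩
    simp [this]
  exact SAlgf.exists_quotient (DualAlg.par A) DualAlg.par_par DualAlg.two_smul_mul I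
    fun x hx a ha => hx _ (D.par_mem a ha)

/-- The superalgebra dual to a finite-dimensional super-subcoalgebra. -/
def alg (D : FinSub A) : SAlgf k := D.exists_dual.choose

/-- The restriction of linear forms to a finite-dimensional super-subcoalgebra. -/
def quot (D : FinSub A) : DualAlg A →ₐ[k] D.alg.carrier := D.exists_dual.choose_spec.choose

theorem quot_surjective (D : FinSub A) : Function.Surjective D.quot :=
  D.exists_dual.choose_spec.choose_spec.1

theorem quot_eq_zero_iff (D : FinSub A) {x : DualAlg A} :
    D.quot x = 0 ↔ ∀ a ∈ D.carrier, val x a = 0 :=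
  D.exists_dual.choose_spec.choose_spec.2.1 x

theorem par_quot (D : FinSub A) (x : DualAlg A) :
    D.alg.par (D.quot x) = D.quot (DualAlg.par A x) :=
  D.exists_dual.choose_spec.choose_spec.2.2 x

theorem exists_pt (D : FinSub A) :
    ∃ u : ((SpStar k).obj A).obj D.alg, ∀ x, evalPt u x = D.quot x :=
  exists_evalPt_eq D.quot D.par_quot D.carrier fun _ hx => D.quot_eq_zero_iff.2 hx

/-- The canonical point of `Sp* A` defined over the dual of a finite-dimensional
super-subcoalgebra. -/
def pt (D : FinSub A) : ((SpStar k).obj A).obj D.alg := D.exists_pt.choose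

@[simp]
theorem evalPt_pt (D : FinSub A) (x : DualAlg A) : evalPt D.pt x = D.quot x :=
  D.exists_pt.choose_spec x

theorem exists_hom (D : FinSub A) {R : SAlgf k} (φ : DualAlg A →ₐ[k] R.carrier)
    (hφ : ∀ x, R.par (φ x) = φ (DualAlg.par A x))
    (h : ∀ x, (∀ a ∈ D.carrier, val x a = 0) → φ x = 0) :
    ∃ m : D.alg ⟶ R, ∀ x, SAlgf.Hom.toAlgHom m (D.quot x) = φ x := by
  obtain ⟨m, hm⟩ := SAlgf.exists_lift D.quot D.quot_surjective φ
    fun x hx => h x (D.quot_eq_zero_iff.1 hx)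
  refine ⟨SAlgf.homMk m fun x => ?_, hm⟩
  obtain ⟨x, rfl⟩ := D.quot_surjective x
  rw [par_quot, hm, hm, hφ]

theorem hom_ext (D : FinSub A) {R : SAlgf k} {s t : D.alg ⟶ R}
    (h : ((SpStar k).obj A).map s D.pt = ((SpStar k).obj A).map t D.pt) : s = t := by
  refine SAlgf.hom_ext' fun x => ?_
  obtain ⟨x, rfl⟩ := D.quot_surjective x
  rw [← evalPt_pt, ← evalPt_map, ← evalPt_map, h]

/-- The dual of a morphism of super-coalgebras restricted to super-subcoalgebras. -/
theorem exists_dualHom (ψ : A ⟶ B) (D : FinSub A) (F : FinSub B)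
    (h : ∀ a ∈ D.carrier, SCoalg.lin ψ a ∈ F.carrier) :
    ∃ m : F.alg ⟶ D.alg, ∀ x, SAlgf.Hom.toAlgHom m (F.quot x) = D.quot (DualAlg.map ψ x) :=
  F.exists_hom (D.quot.comp (DualAlg.map ψ))
    (fun x => by rw [AlgHom.comp_apply, AlgHom.comp_apply, par_quot, DualAlg.map_par])
    (fun x hx => D.quot_eq_zero_iff.2 fun a ha => hx _ (h a ha))

/-- A point of `Sp* A` comes from any super-subcoalgebra on which it is supported. -/
theorem exists_map_pt_eq (D : FinSub A) {R : SAlgf k} (u : ((SpStar k).obj A).obj R)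
    (h : ∀ x : DualAlg A, (∀ a ∈ D.carrier, val x a = 0) → evalPt u x = 0) :
    ∃ m : D.alg ⟶ R, ((SpStar k).obj A).map m D.pt = u := by
  obtain ⟨m, hm⟩ := D.exists_hom (evalPt u) (par_evalPt u) h
  exact ⟨m, evalPt_injective fun x => by rw [evalPt_map, evalPt_pt, hm]⟩

theorem exists_finite_support_pt {R : SAlgf k} (u : ((SpStar k).obj A).obj R) :
    ∃ N : Submodule k A.carrier, Module.Finite k N ∧
      ∀ x : DualAlg A, (∀ a ∈ N, val x a = 0) → evalPt u x = 0 := by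
  obtain ⟨N, hN, h⟩ := exists_finite_contract u.1
  exact ⟨N, hN, fun x hx => h _ hx⟩

/-- Evaluation of the dual algebra at an element of the super-subcoalgebra. -/
theorem exists_eval (D : FinSub A) : ∃ e : D.carrier →ₗ[k] D.alg.carrier →ₗ[k] k,
    ∀ a x, e a (D.quot x) = val x a := by
  obtain ⟨s, hs⟩ := LinearMap.exists_rightInverse_of_surjective D.quot.toLinearMap
    (LinearMap.range_eq_top.2 D.quot_surjective)
  refine ⟨LinearMap.flip ((LinearMap.lcomp k k D.carrier.subtype) ∘ₗ val.toLinearMap ∘ₗ s),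
    fun a x => ?_⟩
  have h : D.quot (s (D.quot x) - x) = 0 := by
    rw [map_sub, sub_eq_zero]
    exact LinearMap.congr_fun hs (D.quot x)
  have := D.quot_eq_zero_iff.1 h a a.2
  rw [map_sub, LinearMap.sub_apply, sub_eq_zero] at this
  exact this

end FinSub

end FormalSuper

namespace FormalSuper

open DualAlg

/-! ### Super-comodules through the action of the dual algebra. -/

section FormTensor

variable {k : Type u} [Field k]
variable {R V W V' W' : Type*} [AddCommGroup R] [Module k R] [AddCommGroup V] [Module k V]
  [AddCommGroup W] [Module k W]

/-- The contraction of the first factor with a linear form. -/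
def contractLeft (f : V →ₗ[k] k) : V ⊗[k] W →ₗ[k] W :=
  (TensorProduct.lid k W).toLinearMap ∘ₗ LinearMap.rTensor W f

@[simp]
theorem contractLeft_tmul (f : V →ₗ[k] k) (v : V) (w : W) :
    contractLeft f (v ⊗ₜ[k] w) = f v • w := by simp [contractLeft]

theorem apply_contractLeft (f : V →ₗ[k] k) (g : W →ₗ[k] k) (t : V ⊗[k] W) :
    g (contractLeft f t) = f (contract g t) := by
  induction t with
  | zero => simp
  | add s t hs ht => simp only [map_add, hs, ht]
  | tmul v w => simp [mul_comm]

theorem contract_rTensor {V' : Type*} [AddCommGroup V'] [Module k V'] (φ : V →ₗ[k] V')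
    (f : W →ₗ[k] k) (t : V ⊗[k] W) :
    contract f (LinearMap.rTensor W φ t) = φ (contract f t) :=
  contract_map φ LinearMap.id f t

theorem contract_formTensor_assoc [AddCommGroup V'] [Module k V'] (f : V →ₗ[k] k) (g : W →ₗ[k] k)
    (t : (V' ⊗[k] V) ⊗[k] W) :
    contract (formTensor f g) (TensorProduct.assoc k V' V W t) = contract f (contract g t) := by
  induction t with
  | zero => simp
  | add s t hs ht => simp only [map_add, hs, ht]
  | tmul s b =>
    induction s with
    | zero => simp
    | add s t hs ht => simp only [TensorProduct.add_tmul, map_add, hs, ht]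
    | tmul v c => simp [smul_smul, mul_comm]

theorem contract_assoc_symm [AddCommGroup V'] [Module k V'] [AddCommGroup W'] [Module k W']
    (ρ : W' →ₗ[k] V ⊗[k] W) (f : W →ₗ[k] k) (t : V' ⊗[k] W') :
    contract f ((TensorProduct.assoc k V' V W).symm (LinearMap.lTensor V' ρ t)) =
      LinearMap.lTensor V' (contract f ∘ₗ ρ) t := by
  induction t with
  | zero => simp
  | add s t hs ht => simp only [map_add, hs, ht]
  | tmul v w =>
    simp only [LinearMap.lTensor_tmul, LinearMap.comp_apply]
    generalize ρ w = s
    induction s with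
    | zero => simp
    | add s t hs ht => simp only [TensorProduct.tmul_add, map_add, hs, ht]
    | tmul v c => simp

end FormTensor

namespace SComod

variable {k : Type u} [Field k] {B : SCoalg k}

/-- The action of the dual algebra on a super-comodule. -/
def act (M : SComod B) (x : DualAlg B) : M.carrier →ₗ[k] M.carrier :=
  contract (val x) ∘ₗ M.coact

/-- Super-comodules in terms of the action of the dual algebra. -/
def ofAct [NeZero (2 : k)] (V : Type u) [AddCommGroup V] [Module k V] (σ : V →ₗ[k] V)
    (hσ : ∀ v, σ (σ v) = v) (ρ : V →ₗ[k] V ⊗[k] B.carrier)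
    (hp : ∀ (x : DualAlg B) v, σ (contract (val x) (ρ v)) = contract (val (DualAlg.par B x)) (ρ (σ v)))
    (hm : ∀ (x y : DualAlg B) v, contract (val x) (ρ (contract (val y) (ρ v))) =
      contract (val (y * x)) (ρ v))
    (h1 : ∀ v, contract (val (1 : DualAlg B)) (ρ v) = v) : SComod B where
  carrier := V
  grading := invGrading σ
  decomposition := invDecomposition σ hσ
  coact := ρ
  coact_isEven := by
    let := invDecomposition σ hσ
    rw [isEven_tensor_iff (invGrading σ) B.grading (invGrading σ)]
    intro v
    refine eq_of_contract fun f => ?_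
    rw [contract_map, par_invGrading]
    have := hp (DualAlg.par B (val.symm f)) v
    rw [DualAlg.par_par] at this
    exact this
  coassoc := by
    ext v
    refine eq_of_contract_tensor fun f g => ?_
    simp only [LinearMap.comp_apply, LinearEquiv.coe_coe]
    rw [contract_formTensor_assoc, contract_rTensor, contract_lTensor]
    exact hm (val.symm f) (val.symm g) v
  counit := LinearMap.ext h1

/-- A linear map which is equivariant for the dual algebra is colinear. -/
def homOfAct {M N : SComod B} (g : M.carrier →ₗ[k] N.carrier)
    (hg : IsEven M.grading N.grading g) (h : ∀ x m, g (M.act x m) = N.act x (g m)) :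
    M.Hom N where
  lin := g
  isEven := hg
  comm := by
    ext m
    refine eq_of_contract fun f => ?_
    rw [LinearMap.comp_apply, LinearMap.comp_apply, contract_rTensor]
    exact (h (val.symm f) m).symm

/-- A super-coalgebra over `B`, as a super-comodule over `B`. -/
def ofHom [NeZero (2 : k)] {A : SCoalg k} (ψ : A ⟶ B) : SComod B :=
  have h : ∀ (x : DualAlg B) (a : A.carrier), contract (val x)
      (LinearMap.lTensor A.carrier (SCoalg.lin ψ) (Coalgebra.comul a)) =
      rightAct (DualAlg.map ψ x) a := fun x a => contract_lTensor _ _ _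
  ofAct A.carrier A.par (FormalSuper.par_par _)
    (LinearMap.lTensor A.carrier (SCoalg.lin ψ) ∘ₗ Coalgebra.comul)
    (fun x v => ext_val fun y => by
      rw [LinearMap.comp_apply, LinearMap.comp_apply, h, h, ← val_par_apply, val_rightAct,
        val_rightAct, ← val_par_apply, map_mul (DualAlg.par A), map_par, DualAlg.par_par])
    (fun x y v => ext_val fun z => by
      rw [LinearMap.comp_apply, LinearMap.comp_apply, h, h, h, val_rightAct, val_rightAct,
        val_rightAct, map_mul (DualAlg.map ψ), mul_assoc])
    (fun v => ext_val fun z => by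
      rw [LinearMap.comp_apply, h, map_one, val_rightAct, one_mul])

theorem act_ofHom [NeZero (2 : k)] {A : SCoalg k} (ψ : A ⟶ B) (x : DualAlg B) (a : A.carrier) :
    (ofHom ψ).act x a = rightAct (DualAlg.map ψ x) a := contract_lTensor _ _ _

theorem par_ofHom [NeZero (2 : k)] {A : SCoalg k} (ψ : A ⟶ B) (a : A.carrier) :
    FormalSuper.par (ofHom ψ).grading a = A.par a := by
  have : FormalSuper.par (ofHom ψ).grading = A.par :=
    par_unique (ofHom ψ).grading (σ := A.par) fun _ _ h => h
  exact LinearMap.congr_fun this a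

/-- A morphism of super-coalgebras over `B` is a morphism of super-comodules. -/
def homOfHom [NeZero (2 : k)] {A : SCoalg k} (ψ : A ⟶ B) : (ofHom ψ).Hom (ofHom (𝟙 B)) :=
  homOfAct (M := ofHom ψ) (N := ofHom (𝟙 B)) (SCoalg.lin ψ)
    ((isEven_iff _ _).2 fun (a : A.carrier) =>
      (par_ofHom (𝟙 B) _).trans ((SCoalg.par_lin ψ a).trans
        (congrArg (SCoalg.lin ψ) (par_ofHom ψ a).symm)))
    fun x (a : A.carrier) => by
      have : SCoalg.lin ψ (rightAct (DualAlg.map ψ x) a) =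
          rightAct (DualAlg.map (𝟙 B) x) (SCoalg.lin ψ a) := ext_val fun y => by
        rw [val_rightAct, ← val_map_apply, val_rightAct, ← val_map_apply, map_mul (DualAlg.map ψ)]
        rfl
      exact (congrArg (SCoalg.lin ψ) (act_ofHom ψ x a)).trans
        (this.trans (act_ofHom (𝟙 B) x _).symm)

end SComod

/-! ### Exactness of `A □_B A → A → B → 0`. -/

section Cotensor

variable {k : Type u} [Field k] {A B : SCoalg k} (ψ : A ⟶ B)

/-- The equalizer condition is an equation in `M ⊗ (B ⊗ A)`, where the forms `F ⊗ Y` separate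
tensors. -/
theorem mem_pullbackSpace {M : SComod B} {x : M.carrier ⊗[k] A.carrier} :
    x ∈ pullbackSpace ψ M ↔ ∀ (F : DualAlg B) (Y : DualAlg A),
      M.act F (contract (val Y) x) = contract (val (Y * DualAlg.map ψ F)) x := by
  have h₁ : ∀ (F : DualAlg B) (Y : DualAlg A), contract (formTensor (val F) (val Y))
      (TensorProduct.assoc k M.carrier B.carrier A.carrier (M.coact.rTensor A.carrier x)) =
      M.act F (contract (val Y) x) := by
    intro F Y
    rw [contract_formTensor_assoc, contract_rTensor]
    rfl
  have h₂ : ∀ (F : DualAlg B) (Y : DualAlg A), contract (formTensor (val F) (val Y))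
      ((leftCoact ψ).lTensor M.carrier x) = contract (val (Y * DualAlg.map ψ F)) x := by
    intro F Y
    rw [contract_lTensor, val_mul, leftCoact, ← LinearMap.comp_assoc]
    congr 2
    have : formTensor (val F) (val Y) ∘ₗ LinearMap.rTensor A.carrier (SCoalg.lin ψ) =
        formTensor (val (DualAlg.map ψ F)) (val Y) := by
      ext a b
      simp [val_map]
    rw [this]
  rw [pullbackSpace, cotensorSubmodule, LinearMap.mem_eqLocus]
  simp only [LinearMap.comp_apply, LinearEquiv.coe_coe]
  constructor
  · intro h F Y
    rw [← h₁, ← h₂, h]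
  · intro h
    refine eq_of_contract_tensor fun f g => ?_
    have := h (val.symm f) (val.symm g)
    rw [← h₁, ← h₂] at this
    exact this

variable [NeZero (2 : k)]

/-- Surjectivity of `ψ` is exactness of `A → B → 0`, with the zero map `B → B` as second arrow.
After cotensoring, `y` in `B □_B A` has the preimage `comul a` with `a = (ε ⊗ id) y`, because `B □_B
A` is identified with `A` by the counit. -/
theorem surjective_of_isFaithfullyCoflat (h : IsFaithfullyCoflat ψ) :
    Function.Surjective (SCoalg.lin ψ) := by
  let M : SComod B := SComod.ofHom ψ
  let N : SComod B := SComod.ofHom (𝟙 B)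
  let g : M.Hom N := SComod.homOfHom ψ
  let z : N.Hom N := ⟨0, fun _ _ _ => zero_mem _, by simp⟩
  have key : Function.Exact (pullbackMap ψ g) (pullbackMap ψ z) := by
    intro y
    refine ⟨fun _ => ?_, fun _ => Subtype.ext ?_⟩
    · let y' : B.carrier ⊗[k] A.carrier := y.1
      have hy : ∀ (F : DualAlg B) (Y : DualAlg A), rightAct F (contract (val Y) y') =
          contract (val (Y * DualAlg.map ψ F)) y' := fun F Y =>
        (SComod.act_ofHom (𝟙 B) F _).symm.trans ((mem_pullbackSpace ψ).1 y.2 F Y)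
      let a : A.carrier := contractLeft Coalgebra.counit y'
      have ha : ∀ Y : DualAlg A, val Y a = val (1 : DualAlg B) (contract (val Y) y') :=
        fun Y => apply_contractLeft _ _ _
      refine ⟨⟨Coalgebra.comul (R := k) (A := A.carrier) a, (mem_pullbackSpace ψ).2 fun F Y => ?_⟩, Subtype.ext ?_⟩
      · refine (SComod.act_ofHom ψ F _).trans ?_
        refine ext_val fun Z => ?_
        change val Z (rightAct _ (rightAct Y a)) = val Z (rightAct _ a)
        rw [val_rightAct, val_rightAct, val_rightAct, mul_assoc]
      · refine eq_of_contract fun f => ?_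
        refine (contract_rTensor _ _ _).trans ?_
        change SCoalg.lin ψ (rightAct (val.symm f) a) = contract (val (val.symm f)) y'
        refine ext_val fun G => ?_
        rw [← val_map_apply, val_rightAct, ha, ← hy, val_rightAct, mul_one]
    · change LinearMap.rTensor _ (0 : N.carrier →ₗ[k] N.carrier) y.1 = 0
      rw [LinearMap.rTensor_zero, LinearMap.zero_apply]
  have hex := (h M N N g z).2 key
  intro b
  exact (hex b).1 rfl

/-- The cotensor square `A □_B A`. -/
def cotensorSq : Submodule k (A.carrier ⊗[k] A.carrier) where
  carrier := {w | ∀ (F : DualAlg B) (Y : DualAlg A),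
    rightAct (DualAlg.map ψ F) (contract (val Y) w) = contract (val (Y * DualAlg.map ψ F)) w}
  add_mem' hv hw F Y := by simp only [map_add, hv F Y, hw F Y]
  zero_mem' F Y := by simp only [map_zero]
  smul_mem' c w hw F Y := by simp only [map_smul, hw F Y]

variable {ψ}

omit [NeZero (2 : k)] in
theorem contract_lTensor_rightAct {V : Type*} [AddCommGroup V] [Module k V] (X Y : DualAlg A)
    (w : V ⊗[k] A.carrier) :
    contract (val X) (LinearMap.lTensor V (rightAct Y) w) = contract (val (Y * X)) w := by
  rw [contract_lTensor]
  congr 2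
  exact LinearMap.ext fun a => val_rightAct _ _ _

omit [NeZero (2 : k)] in
-- On forms on the second factor the balancing condition multiplies from the right and this action
-- from the left, so associativity makes them compatible.
theorem lTensor_rightAct_mem_cotensorSq {w : A.carrier ⊗[k] A.carrier} (hw : w ∈ cotensorSq ψ)
    (Y : DualAlg A) : LinearMap.lTensor A.carrier (rightAct Y) w ∈ cotensorSq ψ := fun F X => by
  rw [contract_lTensor_rightAct, contract_lTensor_rightAct, hw, mul_assoc]

theorem par_rightAct (Y : DualAlg A) (a : A.carrier) :
    A.par (rightAct Y a) = rightAct (DualAlg.par A Y) (A.par a) := ext_val fun Z => by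
  rw [← val_par_apply, val_rightAct, val_rightAct, ← val_par_apply, map_mul (DualAlg.par A),
    DualAlg.par_par]

theorem contract_map_par (X : DualAlg A) (w : A.carrier ⊗[k] A.carrier) :
    contract (val X) (TensorProduct.map A.par A.par w) =
      A.par (contract (val (DualAlg.par A X)) w) := contract_map _ _ _ _

theorem map_par_mem_cotensorSq {w : A.carrier ⊗[k] A.carrier} (hw : w ∈ cotensorSq ψ) :
    TensorProduct.map A.par A.par w ∈ cotensorSq ψ := fun F Y => by
  rw [contract_map_par, contract_map_par, map_mul (DualAlg.par A), ← DualAlg.map_par, ← hw,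
    par_rightAct, ← DualAlg.map_par, DualAlg.par_par]

variable (ψ) in
/-- A retraction onto the cotensor square. -/
def cotensorSqRetract : A.carrier ⊗[k] A.carrier →ₗ[k] cotensorSq ψ :=
  (LinearMap.exists_leftInverse_of_injective (cotensorSq ψ).subtype
    (cotensorSq ψ).ker_subtype).choose

omit [NeZero (2 : k)] in
theorem cotensorSqRetract_comp :
    cotensorSqRetract ψ ∘ₗ (cotensorSq ψ).subtype = LinearMap.id :=
  (LinearMap.exists_leftInverse_of_injective (cotensorSq ψ).subtype
    (cotensorSq ψ).ker_subtype).choose_spec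

variable (ψ) in
/-- The right coaction of `B` on the cotensor square. -/
def cotensorSqCoact : cotensorSq ψ →ₗ[k] cotensorSq ψ ⊗[k] B.carrier :=
  LinearMap.rTensor B.carrier (cotensorSqRetract ψ) ∘ₗ
    (TensorProduct.assoc k A.carrier A.carrier B.carrier).symm.toLinearMap ∘ₗ
    LinearMap.lTensor A.carrier (LinearMap.lTensor A.carrier (SCoalg.lin ψ) ∘ₗ Coalgebra.comul) ∘ₗ
    (cotensorSq ψ).subtype

omit [NeZero (2 : k)] in
-- The retraction in the coaction changes nothing: before it is applied, the contractions already
-- lie in the cotensor square.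
theorem contract_cotensorSqCoact (F : DualAlg B) (w : cotensorSq ψ) :
    (contract (val F) (cotensorSqCoact ψ w)).1 =
      LinearMap.lTensor A.carrier (rightAct (DualAlg.map ψ F)) w := by
  have h : contract (val F) ∘ₗ LinearMap.lTensor A.carrier (SCoalg.lin ψ) ∘ₗ Coalgebra.comul =
      rightAct (DualAlg.map ψ F) := LinearMap.ext fun a => contract_lTensor _ _ _
  have hw := lTensor_rightAct_mem_cotensorSq w.2 (DualAlg.map ψ F)
  rw [cotensorSqCoact, LinearMap.comp_apply, contract_rTensor]
  simp only [LinearMap.comp_apply, LinearEquiv.coe_coe, contract_assoc_symm, h]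
  exact congrArg Subtype.val (LinearMap.congr_fun cotensorSqRetract_comp ⟨_, hw⟩)

variable (ψ) in
/-- The cotensor square as a super-comodule. -/
def cotensorSqComod : SComod B :=
  SComod.ofAct (cotensorSq ψ)
    ((TensorProduct.map A.par A.par).restrict fun _ hw => map_par_mem_cotensorSq hw)
    (fun w => Subtype.ext (eq_of_contract fun f => by
      change contract (val (val.symm f))
        (TensorProduct.map A.par A.par (TensorProduct.map A.par A.par w.1)) = _
      rw [contract_map_par, contract_map_par, DualAlg.par_par, FormalSuper.par_par]
      rfl))
    (cotensorSqCoact ψ)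
    (fun F w => Subtype.ext (eq_of_contract fun f => by
      change contract (val (val.symm f)) (TensorProduct.map A.par A.par
        (contract (val F) (cotensorSqCoact ψ w)).1) = contract (val (val.symm f)) _
      rw [contract_cotensorSqCoact, contract_cotensorSqCoact, contract_map_par,
        contract_lTensor_rightAct, contract_lTensor_rightAct]
      refine Eq.trans ?_ (contract_map_par _ _).symm
      rw [map_mul (DualAlg.par A), ← DualAlg.map_par, DualAlg.par_par]
      rfl))
    (fun F G w => Subtype.ext (eq_of_contract fun f => by
      change contract (val (val.symm f)) _ = contract (val (val.symm f)) _
      rw [contract_cotensorSqCoact, contract_cotensorSqCoact, contract_cotensorSqCoact,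
        contract_lTensor_rightAct, contract_lTensor_rightAct, contract_lTensor_rightAct,
        map_mul (DualAlg.map ψ), mul_assoc]))
    (fun w => Subtype.ext (eq_of_contract fun f => by
      change contract (val (val.symm f)) _ = contract (val (val.symm f)) _
      rw [contract_cotensorSqCoact, contract_lTensor_rightAct, map_one, one_mul]))

theorem act_cotensorSqComod (F : DualAlg B) (w : cotensorSq ψ) :
    ((cotensorSqComod ψ).act F w : cotensorSq ψ).1 =
      LinearMap.lTensor A.carrier (rightAct (DualAlg.map ψ F)) w.1 :=
  contract_cotensorSqCoact F w

theorem par_cotensorSqComod (w : cotensorSq ψ) :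
    FormalSuper.par (cotensorSqComod ψ).grading w =
      ((⟨_, map_par_mem_cotensorSq w.2⟩ : cotensorSq ψ) : (cotensorSqComod ψ).carrier) := by
  have : FormalSuper.par (cotensorSqComod ψ).grading =
      (TensorProduct.map A.par A.par).restrict fun _ hw => map_par_mem_cotensorSq (ψ := ψ) hw :=
    par_unique (cotensorSqComod ψ).grading
      (σ := (TensorProduct.map A.par A.par).restrict fun _ hw => map_par_mem_cotensorSq (ψ := ψ) hw)
      fun _ _ h => h
  exact LinearMap.congr_fun this w

variable (A) in
/-- The difference `id ⊗ ε - ε ⊗ id` of the two projections. -/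
def projDiff : A.carrier ⊗[k] A.carrier →ₗ[k] A.carrier :=
  contract Coalgebra.counit - contractLeft Coalgebra.counit

omit [NeZero (2 : k)] in
theorem val_projDiff (X : DualAlg A) (w : A.carrier ⊗[k] A.carrier) :
    val X (projDiff A w) = val X (contract (val (1 : DualAlg A)) w) -
      val (1 : DualAlg A) (contract (val X) w) := by
  rw [projDiff, LinearMap.sub_apply, map_sub, apply_contractLeft]
  rfl

omit [NeZero (2 : k)] in
-- Colinearity over `B`. For `ε ⊗ id` it is automatic; for `id ⊗ ε` the balancing condition
-- transfers the action from the second factor to the first.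
theorem projDiff_lTensor_rightAct {w : A.carrier ⊗[k] A.carrier} (hw : w ∈ cotensorSq ψ)
    (F : DualAlg B) :
    projDiff A (LinearMap.lTensor A.carrier (rightAct (DualAlg.map ψ F)) w) =
      rightAct (DualAlg.map ψ F) (projDiff A w) := ext_val fun X => by
  rw [val_rightAct, val_projDiff, val_projDiff, contract_lTensor_rightAct,
    contract_lTensor_rightAct, ← val_rightAct, hw, one_mul, mul_one]

omit [NeZero (2 : k)] in
theorem lin_projDiff {w : A.carrier ⊗[k] A.carrier} (hw : w ∈ cotensorSq ψ) :
    SCoalg.lin ψ (projDiff A w) = 0 := ext_val fun F => by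
  have h := hw F 1
  rw [← val_map_apply, val_projDiff, map_zero, sub_eq_zero, ← one_mul (DualAlg.map ψ F), ← hw,
    val_rightAct, one_mul, mul_one]

theorem par_projDiff (w : A.carrier ⊗[k] A.carrier) :
    A.par (projDiff A w) = projDiff A (TensorProduct.map A.par A.par w) := ext_val fun X => by
  rw [← val_par_apply, val_projDiff, val_projDiff, contract_map_par, contract_map_par,
    ← val_par_apply, ← val_par_apply, map_one (DualAlg.par A)]

/-- If `ψ` is faithfully coflat then its kernel is the image of the difference of the two
projections of the cotensor square. -/
theorem exists_projDiff_eq (h : IsFaithfullyCoflat ψ) {a : A.carrier}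
    (ha : SCoalg.lin ψ a = 0) : ∃ w ∈ cotensorSq ψ, projDiff A w = a := by
  let P : SComod B := cotensorSqComod ψ
  let M : SComod B := SComod.ofHom ψ
  let N : SComod B := SComod.ofHom (𝟙 B)
  let g : M.Hom N := SComod.homOfHom ψ
  let d : P.Hom M := SComod.homOfAct (M := P) (N := M) (projDiff A ∘ₗ (cotensorSq ψ).subtype)
    ((isEven_iff _ _).2 fun w => (SComod.par_ofHom ψ _).trans
      ((par_projDiff _).trans (congrArg (fun w : cotensorSq ψ => projDiff A w.1)
        (par_cotensorSqComod w).symm)))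
    (fun F (w : cotensorSq ψ) => (congrArg (projDiff A) (act_cotensorSqComod F w)).trans
      ((projDiff_lTensor_rightAct w.2 F).trans (SComod.act_ofHom ψ F _).symm))
  -- After cotensoring, an element `y` of the kernel has the preimage `(id ⊗ Δ) y`: applying `id ⊗ ε
  -- ⊗ id` returns `y`, while `ε ⊗ id ⊗ id` gives `Δ((ε ⊗ id) y) = 0`, since `ε` on `A` factors
  -- through `ψ`.
  have key : Function.Exact (pullbackMap ψ d) (pullbackMap ψ g) := by
    intro y
    let y' : A.carrier ⊗[k] A.carrier := y.1
    constructor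
    · intro h0
      have hy : y' ∈ cotensorSq ψ := fun F Y =>
        (SComod.act_ofHom ψ F _).symm.trans ((mem_pullbackSpace ψ).1 y.2 F Y)
      have hy0 : ∀ Z : DualAlg A, SCoalg.lin ψ (contract (val Z) y') = 0 := by
        intro Z
        have h0 : LinearMap.rTensor A.carrier (SCoalg.lin ψ) y' = 0 := congrArg Subtype.val h0
        rw [← contract_rTensor, h0, map_zero]
      have hy1 : ∀ Z : DualAlg A, val (1 : DualAlg A) (contract (val Z) y') = 0 := by
        intro Z
        rw [← map_one (DualAlg.map ψ), val_map_apply, hy0, map_zero]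
      -- The retraction only serves to place `(id ⊗ Δ) y'` in the tensor product with the cotensor
      -- square; `hz` shows that no contraction changes.
      let z : cotensorSq ψ ⊗[k] A.carrier :=
        LinearMap.rTensor A.carrier (cotensorSqRetract ψ)
          ((TensorProduct.assoc k A.carrier A.carrier A.carrier).symm
            (LinearMap.lTensor A.carrier Coalgebra.comul y'))
      have hz : ∀ Y : DualAlg A, (contract (val Y) z).1 =
          LinearMap.lTensor A.carrier (rightAct Y) y' := by
        intro Y
        rw [contract_rTensor, contract_assoc_symm]
        exact congrArg Subtype.val (LinearMap.congr_fun cotensorSqRetract_comp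
          ⟨_, lTensor_rightAct_mem_cotensorSq hy Y⟩)
      refine ⟨⟨z, (mem_pullbackSpace ψ).2 fun F Y => Subtype.ext ?_⟩, Subtype.ext ?_⟩
      · refine (act_cotensorSqComod F _).trans ?_
        change _ = (contract (val (Y * DualAlg.map ψ F)) z).1
        refine eq_of_contract fun f => ?_
        change contract (val (val.symm f)) (LinearMap.lTensor A.carrier (rightAct _)
          (contract (val Y) z).1) = contract (val (val.symm f)) _
        rw [hz, hz, contract_lTensor_rightAct, contract_lTensor_rightAct,
          contract_lTensor_rightAct, mul_assoc]
      · refine eq_of_contract fun f => ?_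
        refine (contract_rTensor _ _ _).trans ?_
        change projDiff A (contract (val (val.symm f)) z).1 = contract (val (val.symm f)) y'
        rw [hz]
        refine ext_val fun X => ?_
        rw [val_projDiff, contract_lTensor_rightAct, contract_lTensor_rightAct, hy1, mul_one,
          sub_zero]
    · rintro ⟨z, rfl⟩
      refine Subtype.ext (eq_of_contract fun f => ?_)
      refine (contract_rTensor _ _ _).trans ((congrArg _ (contract_rTensor _ _ _)).trans ?_)
      refine (lin_projDiff (Subtype.prop (p := (· ∈ cotensorSq ψ)) _)).trans ?_
      exact (map_zero _).symm
  obtain ⟨w, hw⟩ := ((h P M N d g).2 key a).1 ha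
  exact ⟨w.1, w.2, hw⟩

end Cotensor

end FormalSuper

/-! ### Descent on a finite-dimensional super-subcoalgebra. -/

namespace FormalSuper

open DualAlg

variable {k : Type u} [Field k]

/-- A morphism with image in the image of an injective morphism factors through it. -/
theorem SAlgf.exists_factor [NeZero (2 : k)] {C E F : SAlgf k} (φ : C ⟶ E) (β : F ⟶ E)
    (hβ : Function.Injective (Hom.toAlgHom β))
    (h : ∀ c, ∃ b, Hom.toAlgHom β b = Hom.toAlgHom φ c) : ∃ m : C ⟶ F, m ≫ β = φ := by
  let e := AlgEquiv.ofInjective (Hom.toAlgHom β) hβ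
  let m : C.carrier →ₐ[k] F.carrier :=
    e.symm.toAlgHom.comp ((Hom.toAlgHom φ).codRestrict (Hom.toAlgHom β).range h)
  have hm : ∀ c, Hom.toAlgHom β (m c) = Hom.toAlgHom φ c := fun c =>
    congrArg Subtype.val (e.apply_symm_apply ⟨Hom.toAlgHom φ c, h c⟩)
  exact ⟨SAlgf.homMk m fun c => hβ (by rw [← par_hom, hm, hm, par_hom]), SAlgf.hom_ext' hm⟩

/-- A linear form on a subspace that vanishes on the kernel of a linear map is induced by a linear
form on the target. -/
theorem exists_dual_comp_eq {V W : Type*} [AddCommGroup V] [Module k V] [AddCommGroup W]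
    [Module k W] (g : V →ₗ[k] W) (N : Submodule k V) (f : V →ₗ[k] k)
    (h : ∀ v ∈ N, g v = 0 → f v = 0) : ∃ y : W →ₗ[k] k, ∀ v ∈ N, y (g v) = f v := by
  have : f ∘ₗ N.subtype ∈ LinearMap.range (g ∘ₗ N.subtype).dualMap := by
    rw [LinearMap.range_dualMap_eq_dualAnnihilator_ker, Submodule.mem_dualAnnihilator]
    exact fun v hv => h v v.2 hv
  obtain ⟨y, hy⟩ := this
  exact ⟨y, fun v hv => LinearMap.congr_fun hy ⟨v, hv⟩⟩

namespace FinSub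

variable [NeZero (2 : k)] {A B : SCoalg k}

/-- The morphism of dual algebras induced by `ψ` on a finite-dimensional super-subcoalgebra and its
image. -/
def coMap (ψ : A ⟶ B) (D : FinSub A) : (D.map ψ).alg ⟶ D.alg :=
  (exists_dualHom ψ D (D.map ψ) fun _ ha => Submodule.mem_map_of_mem ha).choose

theorem coMap_quot (ψ : A ⟶ B) (D : FinSub A) (x : DualAlg B) :
    SAlgf.Hom.toAlgHom (D.coMap ψ) ((D.map ψ).quot x) = D.quot (DualAlg.map ψ x) :=
  (exists_dualHom ψ D (D.map ψ) fun _ ha => Submodule.mem_map_of_mem ha).choose_spec x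

theorem coMap_injective (ψ : A ⟶ B) (D : FinSub A) :
    Function.Injective (SAlgf.Hom.toAlgHom (D.coMap ψ)) := by
  refine (injective_iff_map_eq_zero _).2 fun y hy => ?_
  obtain ⟨x, rfl⟩ := (D.map ψ).quot_surjective y
  rw [coMap_quot, quot_eq_zero_iff] at hy
  rw [quot_eq_zero_iff]
  rintro _ ⟨a, ha, rfl⟩
  exact hy a ha

theorem map_coMap_pt (ψ : A ⟶ B) (D : FinSub A) :
    ((SpStar k).obj B).map (D.coMap ψ) (D.map ψ).pt = ((SpStar k).map ψ).app D.alg D.pt :=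
  evalPt_injective fun x => by rw [evalPt_map, evalPt_pt, coMap_quot, evalPt_app, evalPt_pt]

theorem exists_restrict {D D' : FinSub A} (h : D.carrier ≤ D'.carrier) :
    ∃ r : D'.alg ⟶ D.alg, (∀ x, SAlgf.Hom.toAlgHom r (D'.quot x) = D.quot x) ∧
      ((SpStar k).obj A).map r D'.pt = D.pt := by
  obtain ⟨r, hr⟩ := exists_dualHom (𝟙 A) D D' fun a ha => h ha
  have hr' : ∀ x, SAlgf.Hom.toAlgHom r (D'.quot x) = D.quot x := hr
  exact ⟨r, hr', evalPt_injective fun x => by rw [evalPt_map, evalPt_pt, evalPt_pt, hr']⟩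

/-- The pairing of an element of `D ⊗ D` with a pair of linear forms. -/
theorem exists_pairing (D : FinSub A) {w : A.carrier ⊗[k] A.carrier}
    (hw : w ∈ LinearMap.range (TensorProduct.mapIncl D.carrier D.carrier)) :
    ∃ F : D.alg.carrier ⊗[k] D.alg.carrier →ₗ[k] k,
      ∀ X Y : DualAlg A, F (D.quot Y ⊗ₜ D.quot X) = val X (contract (val Y) w) := by
  obtain ⟨e, he⟩ := D.exists_eval
  obtain ⟨w, rfl⟩ := hw
  induction w with
  | zero => exact ⟨0, fun X Y => by simp⟩
  | add s t hs ht =>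
    obtain ⟨F, hF⟩ := hs
    obtain ⟨G, hG⟩ := ht
    exact ⟨F + G, fun X Y => by simp only [LinearMap.add_apply, map_add, hF, hG]⟩
  | tmul a b =>
    exact ⟨formTensor (e b) (e a), fun X Y => by simp [TensorProduct.mapIncl, he]⟩

/-- Pairing with `w` is a form on `D* ⊗ D*`, and membership in the cotensor square makes it balanced
over `ψ(D)*`, so it factors through the push-out. There its values at `1 ⊗ X` and `X ⊗ 1`, whose
difference is the left-hand side, coincide by `hX`. -/
theorem val_projDiff_eq_zero {ψ : A ⟶ B} {D : FinSub A}
    (Q : SAlgf.Pushout (D.coMap ψ) (D.coMap ψ)) {w : A.carrier ⊗[k] A.carrier}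
    (hw : w ∈ cotensorSq ψ)
    (hw' : w ∈ LinearMap.range (TensorProduct.mapIncl D.carrier D.carrier)) {X : DualAlg A}
    (hX : SAlgf.Hom.toAlgHom Q.inl (D.quot X) = SAlgf.Hom.toAlgHom Q.inr (D.quot X)) :
    val X (projDiff A w) = 0 := by
  obtain ⟨F, hF⟩ := D.exists_pairing hw'
  obtain ⟨G, hG⟩ := Q.exists_functional F fun a b c => by
    obtain ⟨Y, rfl⟩ := D.quot_surjective a
    obtain ⟨b, rfl⟩ := (D.map ψ).quot_surjective b
    obtain ⟨Z, rfl⟩ := D.quot_surjective c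
    rw [coMap_quot, ← map_mul, ← map_mul, hF, hF, ← hw, val_rightAct]
  rw [val_projDiff, ← hF, ← hF, ← hG, ← hG, map_one D.quot, map_one (SAlgf.Hom.toAlgHom Q.inl),
    map_one (SAlgf.Hom.toAlgHom Q.inr), one_mul, mul_one, hX, sub_self]

/-- `ker ψ ∩ D` is finite-dimensional, so finitely many tensors `w` suffice. They need not lie in `D
⊗ D`, which is why a larger `D'` is introduced. -/
theorem exists_le_projDiff {ψ : A ⟶ B} (h : IsFaithfullyCoflat ψ) (D : FinSub A) :
    ∃ D' : FinSub A, D.carrier ≤ D'.carrier ∧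
      ∀ a ∈ D.carrier, SCoalg.lin ψ a = 0 → ∃ w ∈ cotensorSq ψ,
        w ∈ LinearMap.range (TensorProduct.mapIncl D'.carrier D'.carrier) ∧
          projDiff A w = a := by
  let K := D.carrier ⊓ LinearMap.ker (SCoalg.lin ψ)
  have : Module.Finite k K := Submodule.finiteDimensional_inf_left _ _
  obtain ⟨S, hS⟩ : K.FG := Module.Finite.iff_fg.1 this
  have hS' : ∀ s : S, ∃ w ∈ cotensorSq ψ, projDiff A w = s := fun s =>
    exists_projDiff_eq h (hS ▸ Submodule.subset_span s.2 : (s : A.carrier) ∈ K).2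
  choose w hw hw' using hS'
  obtain ⟨M, N, _, _, hMN⟩ :=
    TensorProduct.exists_finite_submodule_of_setFinite (Set.range w) (Set.finite_range w)
  obtain ⟨D', hD'⟩ := exists_le (A := A) (M ⊔ N ⊔ D.carrier)
  refine ⟨D', le_sup_right.trans hD', fun a ha ha' => ?_⟩
  have hle : K ≤ (cotensorSq ψ ⊓
      LinearMap.range (TensorProduct.mapIncl D'.carrier D'.carrier)).map (projDiff A) := by
    rw [← hS, Submodule.span_le]
    intro s hs
    refine ⟨w ⟨s, hs⟩, ⟨hw _, ?_⟩, hw' _⟩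
    have hM : M ≤ D'.carrier := (le_sup_left.trans le_sup_left).trans hD'
    have hN : N ≤ D'.carrier := (le_sup_right.trans le_sup_left).trans hD'
    exact TensorProduct.range_mapIncl_mono hM hN (hMN ⟨_, rfl⟩)
  obtain ⟨w, ⟨h₁, h₂⟩, h₃⟩ := hle ⟨ha, ha'⟩
  exact ⟨w, h₁, h₂, h₃⟩

end FinSub

/-! ### Descent of morphisms and the coequalizer property. -/

section Descent

variable [NeZero (2 : k)] {A B : SCoalg k} {ψ : A ⟶ B} {Z : SFFunt k}

/-- The value of `g` on `D'` is represented by `φ` from a chart of `Z`. The invariance of `g` forces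
the image of `φ`, restricted to `D`, into the forms induced from `ψ(D)`, so `φ` followed by
restriction factors through `coMap ψ D`. -/
theorem exists_descended_point (h : IsFaithfullyCoflat ψ) (hZ : IsFormalSuperscheme k Z)
    (g : (SpStar k).obj A ⟶ Z)
    (hg : ∀ R u v, ((SpStar k).map ψ).app R u = ((SpStar k).map ψ).app R v →
      g.app R u = g.app R v) (D : FinSub A) :
    ∃ z : Z.obj (D.map ψ).alg, Z.map (D.coMap ψ) z = g.app D.alg D.pt := by
  obtain ⟨D', hD, hD'⟩ := FinSub.exists_le_projDiff h D
  obtain ⟨r, hr, hr'⟩ := FinSub.exists_restrict hD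
  obtain ⟨C, ζ, φ, hφ, hζ⟩ := hZ.exists_chart (g.app D'.alg D'.pt)
  obtain ⟨Q⟩ := SAlgf.nonempty_pushout (D'.coMap ψ) (D'.coMap ψ)
  -- The two images of `D'.pt` over the push-out have the same image in `Sp* B`, so `g` identifies
  -- them, and the universal point `ζ` can be cancelled.
  have hQ : φ ≫ Q.inl = φ ≫ Q.inr := by
    refine hζ _ _ _ ?_
    have : ((SpStar k).map ψ).app _ (((SpStar k).obj A).map Q.inl D'.pt) =
        ((SpStar k).map ψ).app _ (((SpStar k).obj A).map Q.inr D'.pt) :=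
      evalPt_injective fun x => by
        rw [evalPt_app, evalPt_app, evalPt_map, evalPt_map, FinSub.evalPt_pt, ← FinSub.coMap_quot,
          ← SAlgf.comp_toAlgHom_apply, Q.w, SAlgf.comp_toAlgHom_apply]
    have := hg _ _ _ this
    rw [NatTrans.naturality_apply, NatTrans.naturality_apply, ← hφ] at this
    simpa only [Functor.map_comp_apply] using this
  obtain ⟨m, hm⟩ := SAlgf.exists_factor (φ ≫ r) (D.coMap ψ) (D.coMap_injective ψ) fun c => by
    obtain ⟨X, hX⟩ := D'.quot_surjective (SAlgf.Hom.toAlgHom φ c)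
    have hX' : SAlgf.Hom.toAlgHom Q.inl (D'.quot X) = SAlgf.Hom.toAlgHom Q.inr (D'.quot X) := by
      rw [hX, ← SAlgf.comp_toAlgHom_apply, hQ, SAlgf.comp_toAlgHom_apply]
    -- `X` kills `ker ψ ∩ D`, because each element there is `projDiff A w` with `w` in both the
    -- cotensor square and `D' ⊗ D'`.
    obtain ⟨y, hy⟩ := exists_dual_comp_eq (SCoalg.lin ψ) D.carrier (val X) fun a ha ha' => by
      obtain ⟨w, hw, hw', rfl⟩ := hD' a ha ha'
      exact FinSub.val_projDiff_eq_zero Q hw hw' hX'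
    refine ⟨(D.map ψ).quot (val.symm y), ?_⟩
    rw [SAlgf.comp_toAlgHom_apply, ← hX, hr, FinSub.coMap_quot, ← sub_eq_zero, ← map_sub,
      FinSub.quot_eq_zero_iff]
    intro a ha
    rw [map_sub, LinearMap.sub_apply, val_map_apply, LinearEquiv.apply_symm_apply, hy a ha,
      sub_self]
  refine ⟨Z.map m ζ, ?_⟩
  rw [← Functor.map_comp_apply, hm, Functor.map_comp_apply, hφ, ← NatTrans.naturality_apply, hr']

/-- Descent along a faithfully coflat morphism of super-coalgebras. -/
theorem existsUnique_descent (h : IsFaithfullyCoflat ψ) (hZ : IsFormalSuperscheme k Z)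
    (g : (SpStar k).obj A ⟶ Z)
    (hg : ∀ R u v, ((SpStar k).map ψ).app R u = ((SpStar k).map ψ).app R v →
      g.app R u = g.app R v) :
    ∃! l : (SpStar k).obj B ⟶ Z, (SpStar k).map ψ ≫ l = g := by
  choose z hz using exists_descended_point h hZ g hg
  -- A point of `Sp* B` is supported on a finite-dimensional `N`. Lifting `N` along a section of `ψ`
  -- and enclosing the lift in some `D` gives `N ⊆ ψ(D)`.
  have hcover : ∀ (R : SAlgf k) (y : ((SpStar k).obj B).obj R), ∃ (D : FinSub A)
      (t : (D.map ψ).alg ⟶ R), ((SpStar k).obj B).map t (D.map ψ).pt = y := by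
    intro R y
    obtain ⟨N, hN, hN'⟩ := FinSub.exists_finite_support_pt y
    obtain ⟨s, hs⟩ := LinearMap.exists_rightInverse_of_surjective (SCoalg.lin ψ)
      (LinearMap.range_eq_top.2 (surjective_of_isFaithfullyCoflat ψ h))
    obtain ⟨D, hD⟩ := FinSub.exists_le (N.map s)
    obtain ⟨t, ht⟩ := (D.map ψ).exists_map_pt_eq y fun x hx => hN' x fun b hb =>
      hx b ⟨s b, hD (Submodule.mem_map_of_mem hb), LinearMap.congr_fun hs b⟩
    exact ⟨D, t, ht⟩
  have hres : ∀ D D' : FinSub A, D.carrier ≤ D'.carrier → ∃ r : (D'.map ψ).alg ⟶ (D.map ψ).alg,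
      ((SpStar k).obj B).map r (D'.map ψ).pt = (D.map ψ).pt ∧ Z.map r (z D') = z D := by
    intro D D' hD
    obtain ⟨r, hr, hr'⟩ := FinSub.exists_restrict hD
    obtain ⟨q, hq, hq'⟩ := FinSub.exists_restrict (D := D.map ψ) (D' := D'.map ψ)
      (Submodule.map_mono hD)
    have hc : q ≫ D.coMap ψ = D'.coMap ψ ≫ r := SAlgf.hom_ext' fun x => by
      obtain ⟨x, rfl⟩ := (D'.map ψ).quot_surjective x
      rw [SAlgf.comp_toAlgHom_apply, SAlgf.comp_toAlgHom_apply, hq, FinSub.coMap_quot,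
        FinSub.coMap_quot, hr]
    -- Compatibility is tested over `D*`, into which `ψ(D)*` injects; there both points are the
    -- value of `g` at `D.pt`.
    refine ⟨q, hq', hZ.map_injective _ (D.coMap_injective ψ) ?_⟩
    rw [← Functor.map_comp_apply, hc, Functor.map_comp_apply, hz, hz,
      ← NatTrans.naturality_apply, hr']
  -- The value does not depend on the chosen `D` and `t`, by comparison inside a common larger `D`.
  -- This gives naturality of the glued map and its compatibility with `g`.
  have huniq : ∀ (R : SAlgf k) (D₁ D₂ : FinSub A) (t₁ : (D₁.map ψ).alg ⟶ R)
      (t₂ : (D₂.map ψ).alg ⟶ R), ((SpStar k).obj B).map t₁ (D₁.map ψ).pt =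
        ((SpStar k).obj B).map t₂ (D₂.map ψ).pt → Z.map t₁ (z D₁) = Z.map t₂ (z D₂) := by
    intro R D₁ D₂ t₁ t₂ ht
    have : Module.Finite k ↥(D₁.carrier ⊔ D₂.carrier) := Submodule.finite_sup _ _
    obtain ⟨D, hD⟩ := FinSub.exists_le (D₁.carrier ⊔ D₂.carrier)
    obtain ⟨r₁, hr₁, hr₁'⟩ := hres D₁ D (le_sup_left.trans hD)
    obtain ⟨r₂, hr₂, hr₂'⟩ := hres D₂ D (le_sup_right.trans hD)
    have : r₁ ≫ t₁ = r₂ ≫ t₂ := FinSub.hom_ext _ (by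
      rw [Functor.map_comp_apply, Functor.map_comp_apply, hr₁, hr₂, ht])
    rw [← hr₁', ← hr₂', ← Functor.map_comp_apply, this, Functor.map_comp_apply]
  choose D t ht using hcover
  let l : (SpStar k).obj B ⟶ Z :=
    { app := fun R => ↾fun y => Z.map (t R y) (z (D R y))
      naturality := fun R S φ => by
        ext y
        change Z.map (t S _) (z (D S _)) = Z.map φ (Z.map (t R y) (z (D R y)))
        rw [← Functor.map_comp_apply]
        refine huniq _ _ _ _ _ ?_
        rw [ht, Functor.map_comp_apply, ht]
        rfl }
  refine ⟨l, ?_, fun l' hl' => ?_⟩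
  · ext R x
    obtain ⟨N, hN, hN'⟩ := FinSub.exists_finite_support_pt x
    obtain ⟨E, hE⟩ := FinSub.exists_le N
    obtain ⟨s, rfl⟩ := E.exists_map_pt_eq x fun y hy => hN' y fun a ha => hy a (hE ha)
    change Z.map (t R (((SpStar k).map ψ).app R _)) (z (D R (((SpStar k).map ψ).app R _))) =
      g.app R (((SpStar k).obj A).map s E.pt)
    rw [NatTrans.naturality_apply g, ← hz, ← Functor.map_comp_apply]
    refine huniq _ _ _ _ _ ?_
    rw [ht, Functor.map_comp_apply, FinSub.map_coMap_pt, NatTrans.naturality_apply]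
  · ext R y
    change l'.app R y = Z.map (t R y) (z (D R y))
    conv_lhs => rw [← ht R y]
    rw [NatTrans.naturality_apply]
    congr 1
    refine hZ.map_injective _ ((D R y).coMap_injective ψ) ?_
    rw [← NatTrans.naturality_apply, FinSub.map_coMap_pt, hz, ← hl']
    rfl

/-- Two points of `X` with equal image in `Y` come from one point of `P`, so a morphism coequalizing
the projections is constant on the fibres of `f`; `existsUnique_descent` then applies through `eX`
and `eY`. -/
theorem nonempty_isColimit_cofork {X Y P : FormalSuperscheme k} {f : X ⟶ Y}
    (hf : IsFaithfullyFlat f) {π₁ π₂ : P ⟶ X} (h : IsPullback π₁ π₂ f f) :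
    Nonempty (IsColimit (Cofork.ofπ f h.w)) := by
  obtain ⟨A, B, eX, eY, ψ, hψ, hc⟩ := hf
  have key : ∀ (W : FormalSuperscheme k) (s : X ⟶ W), π₁ ≫ s = π₂ ≫ s →
      ∃! l : Y ⟶ W, f ≫ l = s := by
    intro W s hs
    have hψ' : (SpStar k).map ψ = eX.inv ≫ f.hom ≫ eY.hom := by
      rw [hψ, Iso.inv_hom_id_assoc]
    obtain ⟨l, hl, hl'⟩ := existsUnique_descent hc W.property (eX.inv ≫ s.hom)
      fun R u v huv => by
        have : f.hom.app R (eX.inv.app R u) = f.hom.app R (eX.inv.app R v) := by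
          have := congrArg (eY.inv.app R) huv
          rw [hψ'] at this
          simpa using this
        obtain ⟨p, hp, hp'⟩ := exists_point_of_isPullback h _ _ this
        have hs' := congrArg (fun m : P ⟶ W => m.hom.app R p) hs
        change s.hom.app R (π₁.hom.app R p) = s.hom.app R (π₂.hom.app R p) at hs'
        rw [hp, hp'] at hs'
        exact hs'
    refine ⟨ObjectProperty.homMk (eY.hom ≫ l), ObjectProperty.hom_ext _ ?_, fun m hm => ?_⟩
    · change f.hom ≫ eY.hom ≫ l = s.hom
      rw [reassoc_of% hψ, hl, Iso.hom_inv_id_assoc]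
    · refine ObjectProperty.hom_ext _ ?_
      change m.hom = eY.hom ≫ l
      rw [← hl' (eY.inv ≫ m.hom), Iso.hom_inv_id_assoc]
      rw [hψ', ← hm]
      simp
  exact ⟨Cofork.IsColimit.ofExistsUnique fun s => key s.pt s.π s.condition⟩

end Descent

end FormalSuper

end

theorem mainTheorem2 {k : Type u} [Field k] (hk : ringChar k ≠ 2)
    {X Y : FormalSuper.FormalSuperscheme k} (f : X ⟶ Y) (hf : FormalSuper.IsFaithfullyFlat f) :
    HasPullback f f ∧
      ∀ (P : FormalSuper.FormalSuperscheme k) (π₁ π₂ : P ⟶ X) (h : IsPullback π₁ π₂ f f),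
        Nonempty (IsColimit (Cofork.ofπ f h.w)) := by
  have : NeZero (2 : k) := ⟨Ring.two_ne_zero hk⟩
  exact ⟨FormalSuper.hasPullback_self f, fun _ _ _ h => FormalSuper.nonempty_isColimit_cofork hf h⟩
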